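/- Let $\mathcal H=\mathbb C^d$ and let $\mathfrak A_\infty$ be the quasilocal $C^*$-algebra of the spin lattice over $\mathbb Z$ with the algebra $M_d(\mathbb C)$ at every site, i.e. the operator norm completion of the union of the local algebras $\mathfrak A_\Lambda=\bigotimes_{x\in\Lambda}M_d(\mathbb C)$ over all finite $\Lambda\subset\mathbb Z$; let $\gamma$ be the automorphism of $\mathfrak A_\infty$ induced by the right shift of $\mathbb Z$. A state $\varphi$ (a normalised positive functional) on $\mathfrak A_\infty$ is called stationary if $\varphi\circ\gamma=\varphi$. A stationary state is called ergodic if it is an extremal point of the set of all stationary states, weakly mixing if $$\lim_{n\to\infty}\frac1n\sum_{i=1}^n\bigl|\varphi(a\,\gamma^i(b))-\varphi(a)\varphi(b)\bigr|=0\qquad\text{for all }a,b\in\mathfrak A_\infty,$$ and strongly mixing if $$\lim_{i\to\infty}\varphi(a\,\gamma^i(b))=\varphi(a)\varphi(b)\qquad\text{for all }a,b\in\mathfrak A_\infty.$$ A family $\{\rho_m\}_{m\ge 1}$ with $\rho_m\in\mathfrak A_{\{1,\dots,m\}}$ is called a stationary (stationary and ergodic, weakly mixing, strongly mixing) quantum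 source if there is a stationary (ergodic, weakly mixing, strongly mixing) state $\varphi$ on $\mathfrak A_\infty$ such that $\varphi(a)=\mathrm{tr}(\rho_m a)$ for all $m$ and all $a\in\mathfrak A_{\{1,\dots,m\}}$; a stationary state is determined by these density operators. Let $\{|\psi_x\rangle\}_{x\in X}$ be a finite linearly independent family of unit vectors in $\mathcal H$, let $\mu$ be a probability measure on the space $X^{\mathbb Z}$ of bi-infinite sequences with its product $\sigma$-algebra, let $T$ be the shift of $X^{\mathbb Z}$, $(T\omega)_k=\omega_{k+1}$, and let $p(x_1,\dots,x_m)=\mu\{\omega:\omega_1=x_1,\dots,\omega_m=x_m\}$. Define the classically correlated quantum source $$\rho_m^{cls}=\sum_{x_1,\dots,x_m\in X}p(x_1,\dots,x_m)\,|\psi_{x_1}\rangle\langle\psi_{x_1}|\otimes\cdots\otimes|\psi_{x_m}\rangle\langle\psi_{x_m}|.$$ Then: 1. if $p$ is stationary, i.e. $T$ preserves $\mu$, then $\{\rho_m^{cls}\}$ is a stationary quantum source; 2. if $p$ is stationary and ergodic, i.e. $T$ preserves $\mu$ and every measurable set $A$ with $T^{-1}A=A$ has measure $0$ or $1$, then $\{\rho_m^{cls}\}$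 is a stationary and ergodic quantum source; 3. if $p$ is stationary and weakly mixing, i.e. $T$ preserves $\mu$ and $\frac1n\sum_{i=1}^n|\mu(A\cap T^{-i}B)-\mu(A)\mu(B)|\to0$ for all measurable $A,B$, then $\{\rho_m^{cls}\}$ is a stationary and weakly mixing quantum source; 4. if $p$ is stationary and strongly mixing, i.e. $T$ preserves $\mu$ and $\mu(A\cap T^{-i}B)\to\mu(A)\mu(B)$ for all measurable $A,B$, then $\{\rho_m^{cls}\}$ is a stationary and strongly mixing quantum source. -/

import Mathlib

noncomputable section

namespace QSource

open scoped ENNReal ComplexOrder InnerProductSpace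
open MeasureTheory Filter Topology

/-! ## The lattice system and its local observables -/

/-- Configurations of the lattice `ℤ` with `d` basis states at every site. -/
abbrev Config (d : ℕ) : Type := ℤ → Fin d

/-- The Hilbert space with orthonormal basis `e_ω` indexed by all configurations `ω`.  Every local
algebra of the lattice acts on it, compatibly with the inclusions of regions; its only role is
to carry the operator norm in which the quasilocal algebra is completed. -/
abbrev ConfigSpace (d : ℕ) : Type := lp (fun _ : Config d => ℂ) 2

/-- The algebra `⨂_{x ∈ Λ} M_d(ℂ)` of observables of the sites in `Λ`, realised as the matrices
indexed by the configurations on `Λ`; the elementary tensors are given by `tensorMatrix`. -/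
abbrev LocalMatrix (d : ℕ) (Λ : Finset ℤ) : Type :=
  Matrix ((x : Λ) → Fin d) ((x : Λ) → Fin d) ℂ

/-- The elementary tensor `⨂_{x ∈ Λ} A x`. -/
def tensorMatrix {d : ℕ} {Λ : Finset ℤ} (A : Λ → Matrix (Fin d) (Fin d) ℂ) : LocalMatrix d Λ :=
  Matrix.of fun ζ η => ∏ x, A x (ζ x) (η x)

lemma memlp_partialComp {d : ℕ} (s : Set (Config d)) (g : Config d → Config d)
    (hg : Set.InjOn g s) (f : ConfigSpace d) (t : Finset (Config d)) :
    ∑ ω ∈ t, ‖s.indicator (fun ω => f (g ω)) ω‖ ^ (2 : ℝ≥0∞).toReal ≤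
      ‖f‖ ^ (2 : ℝ≥0∞).toReal := by
  classical
  calc ∑ ω ∈ t, ‖s.indicator (fun ω => f (g ω)) ω‖ ^ (2 : ℝ≥0∞).toReal
      = ∑ ω ∈ t with ω ∈ s, ‖f (g ω)‖ ^ (2 : ℝ≥0∞).toReal := by
        rw [Finset.sum_filter]
        refine Finset.sum_congr rfl fun ω _ => ?_
        by_cases h : ω ∈ s <;> simp [h]
    _ = ∑ τ ∈ (t.filter (· ∈ s)).image g, ‖f τ‖ ^ (2 : ℝ≥0∞).toReal := by
        rw [Finset.sum_image]
        intro a ha b hb hab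
        exact hg (by simpa using (Finset.mem_filter.1 ha).2)
          (by simpa using (Finset.mem_filter.1 hb).2) hab
    _ ≤ _ := lp.sum_rpow_le_norm_rpow (by norm_num) f _

/-- For `g` injective on `s`, the bounded operator `f ↦ 1_s · (f ∘ g)`. -/
def partialComp {d : ℕ} (s : Set (Config d)) (g : Config d → Config d) (hg : Set.InjOn g s) :
    ConfigSpace d →L[ℂ] ConfigSpace d :=
  LinearMap.mkContinuous
    { toFun := fun f => ⟨s.indicator (fun ω => f (g ω)),
        memℓp_gen' (C := ‖f‖ ^ (2 : ℝ≥0∞).toReal) (memlp_partialComp s g hg f)⟩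
      map_add' := fun f₁ f₂ => by
        ext ω
        change s.indicator (fun ω => (f₁ + f₂) (g ω)) ω =
          s.indicator (fun ω => f₁ (g ω)) ω + s.indicator (fun ω => f₂ (g ω)) ω
        by_cases h : ω ∈ s <;> simp [h]
      map_smul' := fun c f => by
        ext ω
        by_cases h : ω ∈ s <;> simp [h] }
    1 (fun f => by
      rw [one_mul]
      exact lp.norm_le_of_forall_sum_le (by norm_num) (norm_nonneg _)
        (memlp_partialComp s g hg f))

lemma partialComp_apply {d : ℕ} (s : Set (Config d)) (g : Config d → Config d)
    (hg : Set.InjOn g s) (f : ConfigSpace d) (ω : Config d) :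
    partialComp s g hg f ω = s.indicator (fun ω => f (g ω)) ω := rfl

lemma updateFinset_injOn {d : ℕ} (Λ : Finset ℤ) (ζ η : Λ → Fin d) :
    Set.InjOn (fun ω : Config d => Function.updateFinset ω Λ η) {ω | Λ.restrict ω = ζ} := by
  intro ω hω τ hτ h
  funext x
  by_cases hx : x ∈ Λ
  · have h1 := congrFun (hω.trans hτ.symm) ⟨x, hx⟩
    simpa using h1
  · have h1 := congrFun h x
    simpa [Function.updateFinset, hx] using h1

/-- The operator `|ζ⟩⟨η| ⊗ 1`, where `|ζ⟩⟨η|` acts on the sites in `Λ`: it sends the basis vector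
of a configuration equal to `η` on `Λ` to that of the configuration with `η` replaced by `ζ`, and
all other basis vectors to `0`. -/
def matrixUnit {d : ℕ} (Λ : Finset ℤ) (ζ η : Λ → Fin d) : ConfigSpace d →L[ℂ] ConfigSpace d :=
  partialComp {ω | Λ.restrict ω = ζ} (fun ω => Function.updateFinset ω Λ η)
    (updateFinset_injOn Λ ζ η)

/-- The operator `a ⊗ 1`, where `a` acts on the sites in `Λ` and `1` on all the others. -/
def localOp {d : ℕ} (Λ : Finset ℤ) (a : LocalMatrix d Λ) : ConfigSpace d →L[ℂ] ConfigSpace d :=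
  ∑ ζ, ∑ η, a ζ η • matrixUnit Λ ζ η

lemma localOp_apply {d : ℕ} (Λ : Finset ℤ) (a : LocalMatrix d Λ) (f : ConfigSpace d)
    (ω : Config d) :
    localOp Λ a f ω = ∑ η, a (Λ.restrict ω) η * f (Function.updateFinset ω Λ η) := by
  classical
  have h : localOp Λ a f ω = ∑ ζ, ∑ η, a ζ η * matrixUnit Λ ζ η f ω := by
    have hs : ∀ (s : Finset (Λ → Fin d)) (F : (Λ → Fin d) → ConfigSpace d),
        (∑ i ∈ s, F i : ConfigSpace d) ω = ∑ i ∈ s, F i ω := fun s F => by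
      rw [lp.coeFn_sum, Finset.sum_apply]
    simp only [localOp, sum_apply, hs]
    rfl
  rw [h, Finset.sum_eq_single (Λ.restrict ω)]
  · simp [matrixUnit, partialComp_apply]
  · intro ζ _ hζ
    simp [matrixUnit, partialComp_apply, Ne.symm hζ]
  · simp

lemma updateFinset_update {d : ℕ} (Λ : Finset ℤ) (ω : Config d) (ζ η : Λ → Fin d) :
    Function.updateFinset (Function.updateFinset ω Λ ζ) Λ η = Function.updateFinset ω Λ η := by
  funext x
  by_cases hx : x ∈ Λ <;> simp [Function.updateFinset, hx]

lemma restrict_update {d : ℕ} (Λ : Finset ℤ) (ω : Config d) (ζ : Λ → Fin d) :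
    Λ.restrict (Function.updateFinset ω Λ ζ) = ζ := by
  funext x
  simp [Function.updateFinset]

lemma update_restrict {d : ℕ} (Λ : Finset ℤ) (ω : Config d) :
    Function.updateFinset ω Λ (Λ.restrict ω) = ω := by
  funext x
  by_cases hx : x ∈ Λ <;> simp [Function.updateFinset, hx]

lemma localOp_one {d : ℕ} (Λ : Finset ℤ) : localOp Λ (1 : LocalMatrix d Λ) = 1 := by
  ext f ω
  simp [localOp_apply, Matrix.one_apply]

lemma localOp_mul {d : ℕ} (Λ : Finset ℤ) (a b : LocalMatrix d Λ) :
    localOp Λ (a * b) = localOp Λ a * localOp Λ b := by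
  ext f ω
  simp only [localOp_apply, mul_apply_eq_comp, Matrix.mul_apply, restrict_update,
    updateFinset_update, Finset.sum_mul, Finset.mul_sum]
  rw [Finset.sum_comm]
  simp [mul_assoc]

lemma localOp_add {d : ℕ} (Λ : Finset ℤ) (a b : LocalMatrix d Λ) :
    localOp Λ (a + b) = localOp Λ a + localOp Λ b := by
  simp [localOp, add_smul, Finset.sum_add_distrib]

lemma localOp_smul {d : ℕ} (Λ : Finset ℤ) (c : ℂ) (a : LocalMatrix d Λ) :
    localOp Λ (c • a) = c • localOp Λ a := by
  simp [localOp, Finset.smul_sum, mul_smul]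

lemma localOp_star {d : ℕ} (Λ : Finset ℤ) (a : LocalMatrix d Λ) :
    localOp Λ (star a) = star (localOp Λ a) := by
  classical
  ext f ω
  have h1 : star (localOp Λ a) f ω = inner ℂ (localOp Λ a (lp.single 2 ω 1)) f := by
    have := lp.inner_single_left (𝕜 := ℂ) ω (1 : ℂ) (star (localOp Λ a) f)
    rw [ContinuousLinearMap.star_eq_adjoint, ContinuousLinearMap.adjoint_inner_right] at this
    rw [ContinuousLinearMap.star_eq_adjoint, this]
    simp
  have h2 : localOp Λ a (lp.single 2 ω 1) =
      ∑ ζ, lp.single 2 (Function.updateFinset ω Λ ζ) (a ζ (Λ.restrict ω)) := by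
    ext τ
    rw [localOp_apply, lp.coeFn_sum, Finset.sum_apply,
      Finset.sum_eq_single (Λ.restrict ω), Finset.sum_eq_single (Λ.restrict τ)]
    · simp only [lp.single_apply, Pi.single_apply]
      have : Function.updateFinset τ Λ (Λ.restrict ω) = ω ↔
          τ = Function.updateFinset ω Λ (Λ.restrict τ) := by
        constructor <;> intro h
        · rw [← h, updateFinset_update, update_restrict]
        · rw [h, updateFinset_update, update_restrict]
      by_cases h : τ = Function.updateFinset ω Λ (Λ.restrict τ)
      · rw [this.2 h, ← h]
        simp
      · rw [if_neg (fun h' => h (this.1 h')), if_neg h, mul_zero]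
    · intro ζ _ hζ
      rw [lp.single_apply, Pi.single_eq_of_ne]
      intro h
      exact hζ (by rw [h, restrict_update])
    · simp
    · intro ζ _ hζ
      rw [lp.single_apply, Pi.single_eq_of_ne, mul_zero]
      intro h
      exact hζ (by rw [← h, restrict_update])
    · simp
  rw [h1, h2, sum_inner, localOp_apply]
  refine Finset.sum_congr rfl fun ζ _ => ?_
  rw [lp.inner_single_left]
  simp [Matrix.star_apply, mul_comm]

lemma localOp_injective {d : ℕ} [NeZero d] (Λ : Finset ℤ) :
    Function.Injective (localOp (d := d) Λ) := by
  classical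
  intro a b hab
  ext ζ η
  let ω₀ : Config d := fun _ => 0
  have h := congrArg (fun T : ConfigSpace d →L[ℂ] ConfigSpace d =>
    T (lp.single 2 (Function.updateFinset ω₀ Λ η) 1) (Function.updateFinset ω₀ Λ ζ)) hab
  have key : ∀ c : LocalMatrix d Λ, localOp Λ c (lp.single 2 (Function.updateFinset ω₀ Λ η) 1)
      (Function.updateFinset ω₀ Λ ζ) = c ζ η := by
    intro c
    rw [localOp_apply, Finset.sum_eq_single η]
    · simp [restrict_update, updateFinset_update]
    · intro τ _ hτ
      rw [lp.single_apply, Pi.single_eq_of_ne, mul_zero]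
      intro h
      exact hτ (by rw [← restrict_update Λ ω₀ η, ← h, restrict_update])
    · simp
  simpa only [key] using h

/-- Observables of `Λ` are observables of every larger region. -/
lemma localOp_mono {d : ℕ} {Λ Λ' : Finset ℤ} (h : Λ ⊆ Λ') (a : LocalMatrix d Λ) :
    ∃ a' : LocalMatrix d Λ', localOp Λ' a' = localOp Λ a := by
  classical
  let r : (Λ' → Fin d) → (Λ → Fin d) := fun ζ x => ζ ⟨x, h x.2⟩
  let u : (Λ' → Fin d) → (Λ → Fin d) → (Λ' → Fin d) := fun ζ η x =>
    if hx : (x : ℤ) ∈ Λ then η ⟨x, hx⟩ else ζ x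
  refine ⟨Matrix.of fun ζ ξ => ∑ η, if ξ = u ζ η then a (r ζ) η else 0, ?_⟩
  ext f ω
  simp only [localOp_apply, Matrix.of_apply, Finset.sum_mul]
  rw [Finset.sum_comm]
  refine Finset.sum_congr rfl fun η _ => ?_
  rw [Finset.sum_eq_single (u (Λ'.restrict ω) η)]
  · have h1 : Function.updateFinset ω Λ' (u (Λ'.restrict ω) η) = Function.updateFinset ω Λ η := by
      funext x
      by_cases hx : x ∈ Λ
      · simp [Function.updateFinset, hx, h hx, u]
      · by_cases hx' : x ∈ Λ' <;> simp [Function.updateFinset, hx, hx', u]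
    rw [h1, if_pos rfl]
    rfl
  · intro ξ _ hξ
    simp [hξ]
  · simp

/-! ## The quasilocal algebra and the shift -/

/-- The union of the local algebras over all finite regions. -/
def localAlgebra (d : ℕ) : StarSubalgebra ℂ (ConfigSpace d →L[ℂ] ConfigSpace d) where
  carrier := {T | ∃ (Λ : Finset ℤ) (a : LocalMatrix d Λ), localOp Λ a = T}
  mul_mem' := by
    rintro _ _ ⟨Λ₁, a, rfl⟩ ⟨Λ₂, b, rfl⟩
    obtain ⟨a', ha⟩ := localOp_mono (Finset.subset_union_left (s₁ := Λ₁) (s₂ := Λ₂)) a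
    obtain ⟨b', hb⟩ := localOp_mono (Finset.subset_union_right (s₁ := Λ₁) (s₂ := Λ₂)) b
    exact ⟨Λ₁ ∪ Λ₂, a' * b', by rw [localOp_mul, ha, hb]⟩
  add_mem' := by
    rintro _ _ ⟨Λ₁, a, rfl⟩ ⟨Λ₂, b, rfl⟩
    obtain ⟨a', ha⟩ := localOp_mono (Finset.subset_union_left (s₁ := Λ₁) (s₂ := Λ₂)) a
    obtain ⟨b', hb⟩ := localOp_mono (Finset.subset_union_right (s₁ := Λ₁) (s₂ := Λ₂)) b
    exact ⟨Λ₁ ∪ Λ₂, a' + b', by rw [localOp_add, ha, hb]⟩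
  algebraMap_mem' := fun c => ⟨∅, c • 1, by
    rw [localOp_smul, localOp_one, Algebra.algebraMap_eq_smul_one]⟩
  star_mem' := by
    rintro _ ⟨Λ, a, rfl⟩
    exact ⟨Λ, star a, localOp_star Λ a⟩

/-- The quasilocal algebra: the completion of the union of the local algebras in the operator
norm, that is, its closure in the complete algebra of bounded operators.  For `d ≥ 1` each
`localOp Λ` is an injective star homomorphism (`localOp_mul`, `localOp_star`,
`localOp_injective`), hence isometric for the C*-norm of `⨂_{x ∈ Λ} M_d(ℂ)`. -/
abbrev quasilocal (d : ℕ) : StarSubalgebra ℂ (ConfigSpace d →L[ℂ] ConfigSpace d) :=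
  (localAlgebra d).topologicalClosure

/-- A local observable as an element of the quasilocal algebra. -/
def localObs {d : ℕ} (Λ : Finset ℤ) (a : LocalMatrix d Λ) : quasilocal d :=
  ⟨localOp Λ a, (localAlgebra d).le_topologicalClosure ⟨Λ, a, rfl⟩⟩

lemma translate_injOn (d : ℕ) (k : ℤ) :
    Set.InjOn (fun (ω : Config d) x => ω (x + k)) Set.univ := by
  intro ω _ τ _ h
  funext x
  simpa using congrFun h (x - k)

/-- The operator `f ↦ f ∘ T`, where `T` translates configurations by `k`. -/
def translate (d : ℕ) (k : ℤ) : ConfigSpace d →L[ℂ] ConfigSpace d :=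
  partialComp Set.univ (fun ω x => ω (x + k)) (translate_injOn d k)

lemma translate_apply (d : ℕ) (k : ℤ) (f : ConfigSpace d) (ω : Config d) :
    translate d k f ω = f fun x => ω (x + k) := by
  rw [translate, partialComp_apply, Set.indicator_of_mem (Set.mem_univ ω)]

lemma norm_translate_le (d : ℕ) (k : ℤ) (f : ConfigSpace d) : ‖translate d k f‖ ≤ ‖f‖ :=
  lp.norm_le_of_forall_sum_le (by norm_num) (norm_nonneg _) 
    (memlp_partialComp _ _ (translate_injOn d k) f)

lemma translate_neg (d : ℕ) (k : ℤ) (f : ConfigSpace d) :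
    translate d (-k) (translate d k f) = f := by
  ext ω
  simp [translate_apply]

/-- The unitary on the configuration space which moves every configuration one site to the right:
the basis vector of `ω` goes to the basis vector of `x ↦ ω (x - 1)`. -/
def shiftUnitary (d : ℕ) : ConfigSpace d ≃ₗᵢ[ℂ] ConfigSpace d where
  toLinearEquiv := LinearEquiv.ofLinearMap (translate d 1).toLinearMap (translate d (-1)).toLinearMap
    (by
      ext1 f
      simpa using translate_neg d (-1) f)
    (by
      ext1 f
      simpa using translate_neg d 1 f)
  norm_map' f := by
    refine le_antisymm (norm_translate_le d 1 f) ?_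
    have h := norm_translate_le d (-1) (translate d 1 f)
    rw [translate_neg] at h
    exact h

lemma shiftUnitary_apply (d : ℕ) (f : ConfigSpace d) (ω : Config d) :
    shiftUnitary d f ω = f fun x => ω (x + 1) := translate_apply d 1 f ω

lemma shiftUnitary_symm_apply (d : ℕ) (f : ConfigSpace d) (ω : Config d) :
    (shiftUnitary d).symm f ω = f fun x => ω (x - 1) := by
  exact translate_apply d (-1) f ω

/-- Conjugation by the shift maps the observable `a` of the region `Λ` to its copy on `Λ + 1`. -/
lemma conj_shift_localOp {d : ℕ} (Λ : Finset ℤ) (a : LocalMatrix d Λ) :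
    (shiftUnitary d).conjStarAlgEquiv (localOp Λ a) =
      localOp (Λ.map (addRightEmbedding 1))
        (Matrix.of fun ζ η =>
          a (fun x => ζ ⟨x + 1, by simp⟩) (fun x => η ⟨x + 1, by simp⟩)) := by
  classical
  ext f ω
  rw [LinearIsometryEquiv.conjStarAlgEquiv_apply_apply, shiftUnitary_apply, localOp_apply,
    localOp_apply]
  let e : (Λ.map (addRightEmbedding (1 : ℤ)) → Fin d) ≃ (Λ → Fin d) :=
    { toFun := fun ζ x => ζ ⟨x + 1, by simp⟩
      invFun := fun η x => η ⟨x - 1, by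
        obtain ⟨y, hy, hyx⟩ := Finset.mem_map.1 x.2
        have : (x : ℤ) = y + 1 := by simpa using hyx.symm
        simpa [this] using hy⟩
      left_inv := fun ζ => by funext x; simp
      right_inv := fun η => by funext x; simp }
  refine (Fintype.sum_equiv e _ _ fun ζ => ?_).symm
  rw [shiftUnitary_symm_apply]
  refine congrArg₂ (· * ·) rfl (congrArg _ ?_)
  funext x
  by_cases hx : x ∈ Λ.map (addRightEmbedding (1 : ℤ))
  · obtain ⟨y, hy, rfl⟩ := Finset.mem_map.1 hx
    simp [Function.updateFinset, hy, e]
  · have hx' : x - 1 ∉ Λ := fun h => hx (Finset.mem_map.2 ⟨x - 1, h, by simp⟩)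
    simp only [Function.updateFinset, hx, hx', dite_false]
    simp

lemma conj_shift_mem {d : ℕ} (a : quasilocal d) :
    (shiftUnitary d).conjStarAlgEquiv (a : ConfigSpace d →L[ℂ] ConfigSpace d) ∈ quasilocal d := by
  have hc : Continuous fun T : ConfigSpace d →L[ℂ] ConfigSpace d =>
      (shiftUnitary d).conjStarAlgEquiv T := by
    simp only [LinearIsometryEquiv.conjStarAlgEquiv_apply]
    fun_prop
  have ha : (a : ConfigSpace d →L[ℂ] ConfigSpace d) ∈
      closure (localAlgebra d : Set (ConfigSpace d →L[ℂ] ConfigSpace d)) := a.2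
  refine map_mem_closure hc ha ?_
  rintro _ ⟨Λ, b, rfl⟩
  exact ⟨_, _, (conj_shift_localOp Λ b).symm⟩

/-- The automorphism of the quasilocal algebra induced by the right shift of the lattice. -/
def shift (d : ℕ) : quasilocal d →⋆ₐ[ℂ] quasilocal d :=
  StarAlgHom.codRestrict
    (((shiftUnitary d).conjStarAlgEquiv : _ →⋆ₐ[ℂ] _).comp (quasilocal d).subtype)
    (quasilocal d) conj_shift_mem

/-- The shift moves the observable `a` of the region `Λ` to its copy on `Λ + 1`. -/
lemma shift_localObs {d : ℕ} (Λ : Finset ℤ) (a : LocalMatrix d Λ) :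
    shift d (localObs Λ a) = localObs (Λ.map (addRightEmbedding 1))
      (Matrix.of fun ζ η =>
        a (fun x => ζ ⟨x + 1, by simp⟩) (fun x => η ⟨x + 1, by simp⟩)) :=
  Subtype.ext (conj_shift_localOp Λ a)

/-! ## States of the quasilocal algebra -/

/-- A normalised positive functional on the quasilocal algebra. -/
structure IsState {d : ℕ} (φ : quasilocal d →L[ℂ] ℂ) : Prop where
  nonneg : ∀ a, 0 ≤ φ (star a * a)
  map_one : φ 1 = 1

/-- A state invariant under the shift. -/
structure IsStationaryState {d : ℕ} (φ : quasilocal d →L[ℂ] ℂ) : Prop extends IsState φ where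
  map_shift : ∀ a, φ (shift d a) = φ a

/-- An ergodic state: an extremal point of the set of all stationary states. -/
def IsErgodicState {d : ℕ} (φ : quasilocal d →L[ℂ] ℂ) : Prop :=
  φ ∈ Set.extremePoints ℝ {χ : quasilocal d →L[ℂ] ℂ | IsStationaryState χ}

/-- A weakly mixing stationary state. -/
structure IsWeaklyMixingState {d : ℕ} (φ : quasilocal d →L[ℂ] ℂ) : Prop
    extends IsStationaryState φ where
  tendsto : ∀ a b, Tendsto
    (fun n : ℕ => (n : ℝ)⁻¹ * ∑ i ∈ Finset.Icc 1 n, ‖φ (a * (shift d)^[i] b) - φ a * φ b‖)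
    atTop (𝓝 0)

/-- A strongly mixing stationary state. -/
structure IsStronglyMixingState {d : ℕ} (φ : quasilocal d →L[ℂ] ℂ) : Prop
    extends IsStationaryState φ where
  tendsto : ∀ a b, Tendsto (fun i : ℕ => φ (a * (shift d)^[i] b)) atTop (𝓝 (φ a * φ b))

/-! ## Quantum sources as families of density matrices -/

/-- The box `{1, …, m}` of the lattice. -/
abbrev box (m : ℕ) : Finset ℤ := Finset.Icc 1 (m : ℤ)

/-- The state `φ` has the densities `ρ m` on the boxes `{1, …, m}`. -/
def HasDensities {d : ℕ} (φ : quasilocal d →L[ℂ] ℂ) (ρ : (m : ℕ) → LocalMatrix d (box m)) :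
    Prop :=
  ∀ (m : ℕ) (a : LocalMatrix d (box m)), φ (localObs (box m) a) = (ρ m * a).trace

/-- The family `ρ` is a stationary source: it is the family of densities of a stationary state.
(A stationary state is determined by its densities on the boxes `{1, …, m}`.) -/
def IsStationarySource {d : ℕ} (ρ : (m : ℕ) → LocalMatrix d (box m)) : Prop :=
  ∃ φ : quasilocal d →L[ℂ] ℂ, HasDensities φ ρ ∧ IsStationaryState φ

/-- The family `ρ` is a stationary and ergodic source. -/
def IsErgodicSource {d : ℕ} (ρ : (m : ℕ) → LocalMatrix d (box m)) : Prop :=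
  ∃ φ : quasilocal d →L[ℂ] ℂ, HasDensities φ ρ ∧ IsErgodicState φ

/-- The family `ρ` is a stationary and weakly mixing source. -/
def IsWeaklyMixingSource {d : ℕ} (ρ : (m : ℕ) → LocalMatrix d (box m)) : Prop :=
  ∃ φ : quasilocal d →L[ℂ] ℂ, HasDensities φ ρ ∧ IsWeaklyMixingState φ

/-- The family `ρ` is a stationary and strongly mixing source. -/
def IsStronglyMixingSource {d : ℕ} (ρ : (m : ℕ) → LocalMatrix d (box m)) : Prop :=
  ∃ φ : quasilocal d →L[ℂ] ℂ, HasDensities φ ρ ∧ IsStronglyMixingState φ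

/-! ## Classical sources -/

/-- The shift of bi-infinite sequences. -/
def seqShift (ι : Type*) (ω : ℤ → ι) : ℤ → ι := fun x => ω (x + 1)

/-- The probability `p(x₁, …, x_m)` of a word under the law `μ` of a bi-infinite sequence. -/
def wordProb {ι : Type*} [MeasurableSpace ι] (μ : Measure (ℤ → ι)) (m : ℕ) (x : box m → ι) : ℝ :=
  μ.real {ω | ∀ i : box m, ω i = x i}

/-- A measure-preserving map is weakly mixing. -/
structure IsWeaklyMixing {Ω : Type*} [MeasurableSpace Ω] (T : Ω → Ω) (μ : Measure Ω) : Prop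
    extends MeasurePreserving T μ μ where
  tendsto : ∀ A B : Set Ω, MeasurableSet A → MeasurableSet B → Tendsto
    (fun n : ℕ => (n : ℝ)⁻¹ *
      ∑ i ∈ Finset.Icc 1 n, |μ.real (A ∩ T^[i] ⁻¹' B) - μ.real A * μ.real B|)
    atTop (𝓝 0)

/-- A measure-preserving map is strongly mixing. -/
structure IsStronglyMixing {Ω : Type*} [MeasurableSpace Ω] (T : Ω → Ω) (μ : Measure Ω) : Prop
    extends MeasurePreserving T μ μ where
  tendsto : ∀ A B : Set Ω, MeasurableSet A → MeasurableSet B →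
    Tendsto (fun i : ℕ => μ.real (A ∩ T^[i] ⁻¹' B)) atTop (𝓝 (μ.real A * μ.real B))

/-! ## Classically correlated quantum sources -/

/-- The rank-one operator `|v⟩⟨v|`. -/
def ketbra {d : ℕ} (v : EuclideanSpace ℂ (Fin d)) : Matrix (Fin d) (Fin d) ℂ :=
  Matrix.vecMulVec (fun i => v i) (fun i => star (v i))

/-- The classically correlated source with alphabet `ψ` and word probabilities `p`:
`ρ_m = ∑ p(x₁, …, x_m) |ψ_{x₁}⟩⟨ψ_{x₁}| ⊗ ⋯ ⊗ |ψ_{x_m}⟩⟨ψ_{x_m}|`. -/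
def clsSource {d : ℕ} {ι : Type*} [Fintype ι] (ψ : ι → EuclideanSpace ℂ (Fin d))
    (p : (m : ℕ) → (box m → ι) → ℝ) (m : ℕ) : LocalMatrix d (box m) :=
  ∑ x : box m → ι, (p m x : ℂ) • tensorMatrix fun i => ketbra (ψ (x i))

end QSource

end

/-! For a fixed sequence ω, the expectation of a local observable in the product state ⨂ ψ_{ω x}
depends on finitely many letters of ω; this function is `productSymbol`. The state behind the source
is the mixture φ(a) = ∫ `productSymbol` dμ. Two facts tie φ to μ: translating an observable composes
its symbol with the sequence shift (`productSymbol_shift`), and over disjoint regions the product of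
two observables has the product of their symbols (`inner_localOp_mul_productVector`). On overlapping
regions the symbol need not be multiplicative, but translates of two finite regions meet for
boundedly many displacements only (`exists_disjoint_translates`), and this bounded defect disappears
in every limit.

The state itself comes from weak-* compactness (`exists_isMixture`). Its densities are computed from
the symbols, and its stationarity is the invariance of μ on local observables, extended by density.

For large displacements a quantum correlation of local observables is a fixed finite linear
combination of classical correlations of cylinders (`IsMixture.exists_correlation_le`), so both
kinds of mixing pass to local observables. Lipschitz bounds uniform in the displacement extend them
to the whole algebra (`tendsto_mean_correlation`).

Extremality rests on the mean ergodic theorem. If φ(b) = 0 with b local, the time averages of the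
symbol of b tend to 0 in L², and the corresponding quantum mean square φ(A_n* A_n) differs from the
classical one by O(1/n) (`IsMixture.tendsto_birkhoffAverage`). If φ is a proper mixture tχ₁ + sχ₂ of
stationary states, then |χ₁(b)|² = |χ₁(A_n)|² ≤ χ₁(A_n* A_n) ≤ t⁻¹ φ(A_n* A_n) → 0. Applied to b −
φ(b)1, this gives χ₁ = φ (`IsMixture.isErgodicState`). -/

noncomputable section

namespace QSource

open scoped ENNReal ComplexOrder InnerProductSpace
open MeasureTheory Filter Topology

/-! ## Product vectors -/

section ProductVector

variable {d : ℕ} {ι : Type*}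

/-- The matrix element `⟨e_η, (⨂_{x ∈ Λ} |ψ_{ω x}⟩⟨ψ_{ω x}|) e_ζ⟩`. -/
def productWeight (ψ : ι → EuclideanSpace ℂ (Fin d)) (ω : ℤ → ι) (Λ : Finset ℤ)
    (ζ η : Λ → Fin d) : ℂ :=
  ∏ x : Λ, star (ψ (ω x) (ζ x)) * ψ (ω x) (η x)

/-- The expectation of a local observable in the product state `⨂_x ψ_{ω x}`. -/
def productSymbol (ψ : ι → EuclideanSpace ℂ (Fin d)) (Λ : Finset ℤ) (a : LocalMatrix d Λ)
    (ω : ℤ → ι) : ℂ :=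
  ∑ ζ, ∑ η, a ζ η * productWeight ψ ω Λ ζ η

open Classical in
/-- The vector which is `⨂_{x ∈ Λ} ψ_{ω x}` on `Λ` and the basis vector `0` on all other sites. -/
def productVector [NeZero d] (ψ : ι → EuclideanSpace ℂ (Fin d)) (Λ : Finset ℤ) (ω : ℤ → ι) :
    ConfigSpace d :=
  ∑ ζ : Λ → Fin d, lp.single 2 (Function.updateFinset (fun _ => 0) Λ ζ) (∏ x : Λ, ψ (ω x) (ζ x))

lemma productVector_apply [NeZero d] (ψ : ι → EuclideanSpace ℂ (Fin d)) (Λ : Finset ℤ)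
    (ω : ℤ → ι) (ζ : Λ → Fin d) :
    productVector ψ Λ ω (Function.updateFinset (fun _ => 0) Λ ζ) = ∏ x : Λ, ψ (ω x) (ζ x) := by
  classical
  rw [productVector, lp.coeFn_sum, Finset.sum_apply, Finset.sum_eq_single ζ]
  · simp
  · intro τ _ hτ
    rw [lp.single_apply, Pi.single_eq_of_ne]
    intro h
    exact hτ (by rw [← restrict_update Λ (fun _ => 0) τ, ← h, restrict_update])
  · simp

lemma updateFinset_of_subset {Λ Λ' : Finset ℤ} (h : Λ ⊆ Λ') (ω : Config d) (τ : Λ' → Fin d)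
    (η : Λ → Fin d) :
    Function.updateFinset (Function.updateFinset ω Λ' τ) Λ η =
      Function.updateFinset ω Λ' fun x => if hx : (x : ℤ) ∈ Λ then η ⟨x, hx⟩ else τ x := by
  funext x
  by_cases hx : x ∈ Λ
  · simp [Function.updateFinset, hx, h hx]
  · by_cases hx' : x ∈ Λ' <;> simp [Function.updateFinset, hx, hx']

lemma prod_dite_of_subset {Λ Λ' : Finset ℤ} (h : Λ ⊆ Λ') (g : Λ → ℂ) :
    (∏ x : Λ', if hx : (x : ℤ) ∈ Λ then g ⟨x, hx⟩ else 1) = ∏ x : Λ, g x := by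
  classical
  have h1 := Finset.prod_coe_sort Λ' fun x : ℤ => if hx : x ∈ Λ then g ⟨x, hx⟩ else 1
  have h2 := Finset.prod_coe_sort Λ fun x : ℤ => if hx : x ∈ Λ then g ⟨x, hx⟩ else 1
  rw [h1, ← Finset.prod_subset h (fun x _ hx => by simp [hx]), ← h2]
  exact Finset.prod_congr rfl fun x _ => by simp

/-- The inner product factorises over the sites of Λ', and each site outside Λ contributes ‖ψ‖² = 1.
The value is therefore independent of Λ', which is what makes the finite-volume states consistent.
-/
lemma inner_matrixUnit_productVector [NeZero d] {ψ : ι → EuclideanSpace ℂ (Fin d)}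
    (hψ : ∀ i, ‖ψ i‖ = 1) {Λ Λ' : Finset ℤ} (h : Λ ⊆ Λ') (ω : ℤ → ι) (ζ η : Λ → Fin d) :
    ⟪productVector ψ Λ' ω, matrixUnit Λ ζ η (productVector ψ Λ' ω)⟫_ℂ =
      productWeight ψ ω Λ ζ η := by
  classical
  -- The contribution of the site x when the left vector is in the basis state k: inside Λ only k =
  -- ζ x survives, outside Λ nothing is changed.
  let g : Λ' → Fin d → ℂ := fun x k =>
    if hx : (x : ℤ) ∈ Λ then
      if k = ζ ⟨x, hx⟩ then star (ψ (ω x) (ζ ⟨x, hx⟩)) * ψ (ω x) (η ⟨x, hx⟩) else 0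
    else star (ψ (ω x) k) * ψ (ω x) k
  have hg : ∀ x : Λ', ∑ k, g x k =
      if hx : (x : ℤ) ∈ Λ then star (ψ (ω x) (ζ ⟨x, hx⟩)) * ψ (ω x) (η ⟨x, hx⟩) else 1 := by
    intro x
    by_cases hx : (x : ℤ) ∈ Λ
    · simp [g, hx]
    · have := inner_self_eq_norm_sq_to_K (𝕜 := ℂ) (ψ (ω x))
      rw [hψ, PiLp.inner_apply] at this
      simp only [g, hx, dite_false]
      simpa [Complex.conj_mul'] using this
  calc ⟪productVector ψ Λ' ω, matrixUnit Λ ζ η (productVector ψ Λ' ω)⟫_ℂ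
      = ∑ τ : Λ' → Fin d, ∏ x, g x (τ x) := by
        conv_lhs => rw [productVector]
        rw [sum_inner]
        refine Finset.sum_congr rfl fun τ _ => ?_
        rw [lp.inner_single_left, matrixUnit, partialComp_apply]
        by_cases hτ : Λ.restrict (Function.updateFinset (fun _ => (0 : Fin d)) Λ' τ) = ζ
        · have hτ' : ∀ (x : Λ') (hx : (x : ℤ) ∈ Λ), τ x = ζ ⟨x, hx⟩ := by
            intro x hx
            rw [← hτ]
            simp [Function.updateFinset]
          rw [Set.indicator_of_mem (by exact hτ)]
          rw [← productVector, updateFinset_of_subset h, productVector_apply]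
          simp only [RCLike.inner_apply, map_prod]
          rw [← Finset.prod_mul_distrib]
          refine Finset.prod_congr rfl fun x _ => ?_
          by_cases hx : (x : ℤ) ∈ Λ
          · simp [g, hx, hτ', mul_comm]
          · simp [g, hx, mul_comm]
        · rw [Set.indicator_of_notMem (by exact hτ), inner_zero_right]
          obtain ⟨x, hx⟩ := Function.ne_iff.1 hτ
          symm
          refine Finset.prod_eq_zero (Finset.mem_univ ⟨x, h x.2⟩) ?_
          have hx' : τ ⟨x, h x.2⟩ ≠ ζ x := by
            simpa [Function.updateFinset, h x.2] using hx
          simp [g, hx']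
    _ = ∏ x, ∑ k, g x k := by
        rw [Finset.prod_univ_sum, Fintype.piFinset_univ]
    _ = productWeight ψ ω Λ ζ η := by
        simp only [hg]
        exact prod_dite_of_subset h fun x => star (ψ (ω x) (ζ x)) * ψ (ω x) (η x)

lemma inner_localOp_productVector [NeZero d] {ψ : ι → EuclideanSpace ℂ (Fin d)}
    (hψ : ∀ i, ‖ψ i‖ = 1) {Λ Λ' : Finset ℤ} (h : Λ ⊆ Λ') (ω : ℤ → ι) (a : LocalMatrix d Λ) :
    ⟪productVector ψ Λ' ω, localOp Λ a (productVector ψ Λ' ω)⟫_ℂ = productSymbol ψ Λ a ω := by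
  simp only [localOp, sum_apply, inner_sum, productSymbol]
  refine Finset.sum_congr rfl fun ζ _ => Finset.sum_congr rfl fun η _ => ?_
  rw [← inner_matrixUnit_productVector hψ h, ← inner_smul_right]
  rfl

/-- The configuration on `Λ₁ ∪ Λ₂` which is `ζ` on `Λ₁` and `ξ` on the rest of `Λ₂`. -/
def glue {Λ₁ Λ₂ : Finset ℤ} (ζ : Λ₁ → Fin d) (ξ : Λ₂ → Fin d) (x : (Λ₁ ∪ Λ₂ : Finset ℤ)) :
    Fin d :=
  if h : (x : ℤ) ∈ Λ₁ then ζ ⟨x, h⟩ else ξ ⟨x, (Finset.mem_union.1 x.2).resolve_left h⟩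

lemma matrixUnit_mul_of_disjoint {Λ₁ Λ₂ : Finset ℤ} (h : Disjoint Λ₁ Λ₂) (ζ η : Λ₁ → Fin d)
    (ξ θ : Λ₂ → Fin d) :
    matrixUnit Λ₁ ζ η * matrixUnit Λ₂ ξ θ = matrixUnit (Λ₁ ∪ Λ₂) (glue ζ ξ) (glue η θ) := by
  classical
  have hd : ∀ {x}, x ∈ Λ₂ → x ∉ Λ₁ := fun h2 h1 => Finset.disjoint_left.1 h h1 h2
  ext f ω
  rw [mul_apply_eq_comp, matrixUnit, matrixUnit, matrixUnit, partialComp_apply,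
    partialComp_apply]
  have hu : Function.updateFinset (Function.updateFinset ω Λ₁ η) Λ₂ θ =
      Function.updateFinset ω (Λ₁ ∪ Λ₂) (glue η θ) := by
    funext x
    by_cases h1 : x ∈ Λ₁
    · have h2 : x ∉ Λ₂ := fun h2 => hd h2 h1
      simp [Function.updateFinset, h1, h2, glue]
    · by_cases h2 : x ∈ Λ₂ <;> simp [Function.updateFinset, h1, h2, glue]
  have hr : (Λ₁ ∪ Λ₂).restrict ω = glue ζ ξ ↔
      Λ₁.restrict ω = ζ ∧ Λ₂.restrict (Function.updateFinset ω Λ₁ η) = ξ := by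
    simp only [funext_iff, Subtype.forall, Finset.restrict, glue, Function.updateFinset]
    constructor
    · intro H
      refine ⟨fun x hx => by simpa [hx] using H x (Finset.mem_union_left _ hx), fun x hx => ?_⟩
      simpa [hd hx] using H x (Finset.mem_union_right _ hx)
    · rintro ⟨H1, H2⟩ x hx
      by_cases h1 : x ∈ Λ₁
      · simp [h1, H1 x h1]
      · have h2 := (Finset.mem_union.1 hx).resolve_left h1
        simpa [h1] using H2 x h2
  by_cases h1 : Λ₁.restrict ω = ζ
  · rw [Set.indicator_of_mem (by exact h1), partialComp_apply]
    by_cases h2 : Λ₂.restrict (Function.updateFinset ω Λ₁ η) = ξ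
    · rw [Set.indicator_of_mem (by exact h2), Set.indicator_of_mem (by exact hr.2 ⟨h1, h2⟩), hu]
    · rw [Set.indicator_of_notMem (by exact h2),
        Set.indicator_of_notMem (fun H => h2 (hr.1 (by exact H)).2)]
  · rw [Set.indicator_of_notMem (by exact h1), Set.indicator_of_notMem (fun H => h1 (hr.1 (by exact H)).1)]

lemma productWeight_glue (ψ : ι → EuclideanSpace ℂ (Fin d)) (ω : ℤ → ι) {Λ₁ Λ₂ : Finset ℤ}
    (h : Disjoint Λ₁ Λ₂) (ζ η : Λ₁ → Fin d) (ξ θ : Λ₂ → Fin d) :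
    productWeight ψ ω (Λ₁ ∪ Λ₂) (glue ζ ξ) (glue η θ) =
      productWeight ψ ω Λ₁ ζ η * productWeight ψ ω Λ₂ ξ θ := by
  classical
  have hd : ∀ {x}, x ∈ Λ₂ → x ∉ Λ₁ := fun h2 h1 => Finset.disjoint_left.1 h h1 h2
  unfold productWeight
  rw [← prod_dite_of_subset (Finset.subset_union_left (s₁ := Λ₁) (s₂ := Λ₂)),
    ← prod_dite_of_subset (Finset.subset_union_right (s₁ := Λ₁) (s₂ := Λ₂)),
    ← Finset.prod_mul_distrib]
  refine Finset.prod_congr rfl fun x _ => ?_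
  by_cases h1 : (x : ℤ) ∈ Λ₁
  · have h2 : (x : ℤ) ∉ Λ₂ := fun h2 => hd h2 h1
    simp [h1, h2, glue]
  · have h2 := (Finset.mem_union.1 x.2).resolve_left h1
    simp [h1, h2, glue]

lemma inner_localOp_mul_productVector [NeZero d] {ψ : ι → EuclideanSpace ℂ (Fin d)}
    (hψ : ∀ i, ‖ψ i‖ = 1) {Λ₁ Λ₂ Λ' : Finset ℤ} (hd : Disjoint Λ₁ Λ₂) (h : Λ₁ ∪ Λ₂ ⊆ Λ')
    (ω : ℤ → ι) (a : LocalMatrix d Λ₁) (b : LocalMatrix d Λ₂) :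
    ⟪productVector ψ Λ' ω, (localOp Λ₁ a * localOp Λ₂ b) (productVector ψ Λ' ω)⟫_ℂ =
      productSymbol ψ Λ₁ a ω * productSymbol ψ Λ₂ b ω := by
  have hexp : localOp Λ₁ a * localOp Λ₂ b = ∑ ζ, ∑ η, ∑ ξ, ∑ θ,
      (a ζ η * b ξ θ) • matrixUnit (Λ₁ ∪ Λ₂) (glue ζ ξ) (glue η θ) := by
    simp only [localOp, Finset.sum_mul]
    refine Finset.sum_congr rfl fun ζ _ => Finset.sum_congr rfl fun η _ => ?_
    simp only [Finset.mul_sum]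
    refine Finset.sum_congr rfl fun ξ _ => Finset.sum_congr rfl fun θ _ => ?_
    rw [smul_mul_smul_comm, matrixUnit_mul_of_disjoint hd]
  rw [hexp]
  simp only [sum_apply, inner_sum, productSymbol, Finset.sum_mul]
  refine Finset.sum_congr rfl fun ζ _ => Finset.sum_congr rfl fun η _ => ?_
  simp only [Finset.mul_sum]
  refine Finset.sum_congr rfl fun ξ _ => Finset.sum_congr rfl fun θ _ => ?_
  rw [mul_mul_mul_comm, ← productWeight_glue ψ ω hd, ← inner_matrixUnit_productVector hψ h,
    ← inner_smul_right]
  rfl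

lemma productSymbol_one {ψ : ι → EuclideanSpace ℂ (Fin d)} (ω : ℤ → ι) :
    productSymbol ψ ∅ 1 ω = 1 := by
  simp [productSymbol, productWeight]

lemma inner_self_productVector [NeZero d] {ψ : ι → EuclideanSpace ℂ (Fin d)}
    (hψ : ∀ i, ‖ψ i‖ = 1) (Λ : Finset ℤ) (ω : ℤ → ι) :
    ⟪productVector ψ Λ ω, productVector ψ Λ ω⟫_ℂ = 1 := by
  have h := inner_localOp_productVector hψ (Finset.empty_subset Λ) ω 1
  rwa [localOp_one, productSymbol_one] at h

lemma productSymbol_star [NeZero d] {ψ : ι → EuclideanSpace ℂ (Fin d)} (hψ : ∀ i, ‖ψ i‖ = 1)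
    (Λ : Finset ℤ) (a : LocalMatrix d Λ) (ω : ℤ → ι) :
    productSymbol ψ Λ (star a) ω = star (productSymbol ψ Λ a ω) := by
  rw [← inner_localOp_productVector hψ subset_rfl, ← inner_localOp_productVector hψ subset_rfl,
    localOp_star, ContinuousLinearMap.star_eq_adjoint, ContinuousLinearMap.adjoint_inner_right]
  exact (inner_conj_symm _ _).symm

lemma productSymbol_shift (ψ : ι → EuclideanSpace ℂ (Fin d)) (Λ : Finset ℤ)
    (a : LocalMatrix d Λ) (ω : ℤ → ι) :
    productSymbol ψ (Λ.map (addRightEmbedding 1)) (Matrix.of fun ζ η =>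
      a (fun x => ζ ⟨x + 1, by simp⟩) (fun x => η ⟨x + 1, by simp⟩)) ω =
      productSymbol ψ Λ a (seqShift ι ω) := by
  let s : Λ ≃ (Λ.map (addRightEmbedding (1 : ℤ)) : Finset ℤ) :=
    { toFun := fun x => ⟨x + 1, by simp⟩
      invFun := fun x => ⟨x - 1, by
        obtain ⟨y, hy, hyx⟩ := Finset.mem_map.1 x.2
        have : (x : ℤ) = y + 1 := by simpa using hyx.symm
        simpa [this] using hy⟩
      left_inv := fun x => by simp
      right_inv := fun x => by simp }
  let e := Equiv.arrowCongr s (Equiv.refl (Fin d))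
  unfold productSymbol
  refine (Fintype.sum_equiv e _ _ fun ζ => Fintype.sum_equiv e _ _ fun η => ?_).symm
  refine congrArg₂ (· * ·) ?_ ?_
  · simp only [Matrix.of_apply]
    refine congrArg₂ a ?_ ?_ <;> funext x <;> exact congrArg _ (s.symm_apply_apply x).symm
  · refine Fintype.prod_equiv s _ _ fun x => ?_
    have he : ∀ ζ : Λ → Fin d, e ζ (s x) = ζ x := fun ζ => congrArg ζ (s.symm_apply_apply x)
    rw [he, he]
    rfl

/-- The translated matrix lives over a different index set for each n, so it is given only through
its region and its symbol, the two data used later. -/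
lemma exists_shift_iterate_localObs (ψ : ι → EuclideanSpace ℂ (Fin d)) (Λ : Finset ℤ)
    (a : LocalMatrix d Λ) (n : ℕ) :
    ∃ b : LocalMatrix d (Λ.map (addRightEmbedding (n : ℤ))),
      (shift d)^[n] (localObs Λ a) = localObs _ b ∧
        ∀ ω, productSymbol ψ _ b ω = productSymbol ψ Λ a ((seqShift ι)^[n] ω) := by
  induction n with
  | zero =>
    have h : Λ.map (addRightEmbedding ((0 : ℕ) : ℤ)) = Λ := by ext; simp
    rw [h]
    exact ⟨a, rfl, fun _ => rfl⟩
  | succ n ih =>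
    obtain ⟨b, hb, hsym⟩ := ih
    have h : Λ.map (addRightEmbedding ((n + 1 : ℕ) : ℤ)) =
        (Λ.map (addRightEmbedding (n : ℤ))).map (addRightEmbedding 1) := by
      ext x
      simp only [Finset.mem_map, addRightEmbedding_apply, Nat.cast_add, Nat.cast_one]
      constructor
      · rintro ⟨y, hy, rfl⟩
        exact ⟨y + n, ⟨y, hy, rfl⟩, by ring⟩
      · rintro ⟨_, ⟨y, hy, rfl⟩, rfl⟩
        exact ⟨y, hy, by ring⟩
    rw [h]
    refine ⟨_, by rw [Function.iterate_succ_apply', hb, shift_localObs], fun ω => ?_⟩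
    rw [productSymbol_shift, hsym, Function.iterate_succ_apply]

lemma productSymbol_congr (ψ : ι → EuclideanSpace ℂ (Fin d)) {Λ : Finset ℤ}
    (a : LocalMatrix d Λ) {ω τ : ℤ → ι} (h : Λ.restrict ω = Λ.restrict τ) :
    productSymbol ψ Λ a ω = productSymbol ψ Λ a τ := by
  have h' : ∀ x : Λ, ω x = τ x := fun x => congrFun h x
  simp [productSymbol, productWeight, h']

lemma productVector_congr [NeZero d] (ψ : ι → EuclideanSpace ℂ (Fin d)) {Λ : Finset ℤ}
    {ω τ : ℤ → ι} (h : Λ.restrict ω = Λ.restrict τ) :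
    productVector ψ Λ ω = productVector ψ Λ τ := by
  have h' : ∀ x : Λ, ω x = τ x := fun x => congrFun h x
  simp [productVector, h']

end ProductVector

/-! ## Functions of finitely many letters -/

section Cylinder

variable {ι : Type*}

/-- The function `f` depends only on the letters in `Λ`. -/
def DependsOnLetters {E : Type*} (f : (ℤ → ι) → E) (Λ : Finset ℤ) : Prop :=
  ∃ g : (Λ → ι) → E, f = g ∘ Λ.restrict

lemma DependsOnLetters.of_congr {E : Type*} [Nonempty E] {f : (ℤ → ι) → E} {Λ : Finset ℤ}
    (h : ∀ ω τ, Λ.restrict ω = Λ.restrict τ → f ω = f τ) : DependsOnLetters f Λ := by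
  have hf : Function.FactorsThrough f (Λ.restrict (π := fun _ => ι)) := fun ω τ => h ω τ
  exact ⟨_, (hf.extend_comp fun _ => Classical.arbitrary E).symm⟩

lemma DependsOnLetters.exists_bound [Fintype ι] {E : Type*} [NormedAddCommGroup E] {f : (ℤ → ι) → E}
    {Λ : Finset ℤ} (h : DependsOnLetters f Λ) : ∃ C, 0 ≤ C ∧ ∀ ω, ‖f ω‖ ≤ C := by
  obtain ⟨g, rfl⟩ := h
  exact ⟨∑ x, ‖g x‖, Finset.sum_nonneg fun _ _ => norm_nonneg _, fun ω =>
    Finset.single_le_sum (f := fun x => ‖g x‖) (fun _ _ => norm_nonneg _) (Finset.mem_univ _)⟩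

variable [Fintype ι] [MeasurableSpace ι] [DiscreteMeasurableSpace ι]

lemma DependsOnLetters.stronglyMeasurable {E : Type*} [TopologicalSpace E] {f : (ℤ → ι) → E}
    {Λ : Finset ℤ} (h : DependsOnLetters f Λ) : StronglyMeasurable f := by
  obtain ⟨g, rfl⟩ := h
  exact (StronglyMeasurable.of_discrete (f := g)).comp_measurable (Finset.measurable_restrict Λ)

lemma DependsOnLetters.memLp {E : Type*} [NormedAddCommGroup E] {f : (ℤ → ι) → E}
    {Λ : Finset ℤ} (h : DependsOnLetters f Λ) (p : ℝ≥0∞) (μ : Measure (ℤ → ι))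
    [IsFiniteMeasure μ] : MemLp f p μ := by
  obtain ⟨C, -, hC⟩ := h.exists_bound
  exact .of_bound h.stronglyMeasurable.aestronglyMeasurable C (.of_forall hC)

lemma DependsOnLetters.integrable {E : Type*} [NormedAddCommGroup E] {f : (ℤ → ι) → E}
    {Λ : Finset ℤ} (h : DependsOnLetters f Λ) (μ : Measure (ℤ → ι)) [IsFiniteMeasure μ] :
    Integrable f μ :=
  memLp_one_iff_integrable.1 (h.memLp 1 μ)

lemma integral_comp_restrict (μ : Measure (ℤ → ι)) [IsFiniteMeasure μ] {Λ : Finset ℤ}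
    (g : (Λ → ι) → ℂ) :
    ∫ ω, g (Λ.restrict ω) ∂μ = ∑ x, (μ.real {ω | ∀ i : Λ, ω i = x i} : ℂ) * g x := by
  refine (integral_map (φ := Finset.restrict (π := fun _ => ι) Λ) (f := g)
    (Finset.measurable_restrict Λ).aemeasurable .of_discrete).symm.trans ?_
  rw [integral_fintype .of_finite]
  refine Finset.sum_congr rfl fun x _ => ?_
  rw [map_measureReal_apply (Finset.measurable_restrict Λ) (measurableSet_singleton x),
    Complex.real_smul]
  congr 3
  ext ω
  simp [funext_iff]

end Cylinder

/-! ## Mixtures of product states -/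

section Mixture

variable {d : ℕ} {ι : Type*}

/-- The functional `a ↦ ⟨v, a v⟩`. -/
def vectorFunctional (v : ConfigSpace d) : quasilocal d →L[ℂ] ℂ :=
  LinearMap.mkContinuous
    { toFun := fun a => ⟪v, (a : ConfigSpace d →L[ℂ] ConfigSpace d) v⟫_ℂ
      map_add' := fun a b => by simp
      map_smul' := fun c a => by simp }
    (‖v‖ ^ 2) fun a => by
      refine (norm_inner_le_norm (𝕜 := ℂ) v _).trans ?_
      calc ‖v‖ * ‖(a : ConfigSpace d →L[ℂ] ConfigSpace d) v‖ ≤ ‖v‖ * (‖a‖ * ‖v‖) := by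
            gcongr
            exact (a : ConfigSpace d →L[ℂ] ConfigSpace d).le_opNorm v
        _ = ‖v‖ ^ 2 * ‖a‖ := by ring

lemma norm_vectorFunctional_le (v : ConfigSpace d) : ‖vectorFunctional v‖ ≤ ‖v‖ ^ 2 :=
  LinearMap.mkContinuous_norm_le _ (by positivity) _

lemma vectorFunctional_nonneg (v : ConfigSpace d) (a : quasilocal d) :
    0 ≤ vectorFunctional v (star a * a) := by
  have h : vectorFunctional v (star a * a) =
      ⟪(a : ConfigSpace d →L[ℂ] ConfigSpace d) v, (a : ConfigSpace d →L[ℂ] ConfigSpace d) v⟫_ℂ := by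
    rw [← ContinuousLinearMap.adjoint_inner_right, ← ContinuousLinearMap.star_eq_adjoint]
    rfl
  rw [h, inner_self_eq_norm_sq_to_K, ← RCLike.ofReal_pow]
  exact Complex.zero_le_real.2 (sq_nonneg _)

lemma dependsOnLetters_productSymbol (ψ : ι → EuclideanSpace ℂ (Fin d)) (Λ : Finset ℤ)
    (a : LocalMatrix d Λ) : DependsOnLetters (productSymbol ψ Λ a) Λ :=
  .of_congr fun _ _ h => productSymbol_congr ψ a h

variable [Fintype ι] [MeasurableSpace ι] [DiscreteMeasurableSpace ι]

/-- The state `φ` is the mixture `∫ (⨂_x ψ_{ω x}) dμ(ω)` of product states. -/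
structure IsMixture (φ : quasilocal d →L[ℂ] ℂ) (ψ : ι → EuclideanSpace ℂ (Fin d))
    (μ : Measure (ℤ → ι)) : Prop where
  isState : IsState φ
  norm_le : ‖φ‖ ≤ 1
  apply_localObs : ∀ Λ a, φ (localObs Λ a) = ∫ ω, productSymbol ψ Λ a ω ∂μ
  apply_mul : ∀ Λ₁ Λ₂ a b, Disjoint Λ₁ Λ₂ → φ (localObs Λ₁ a * localObs Λ₂ b) =
    ∫ ω, productSymbol ψ Λ₁ a ω * productSymbol ψ Λ₂ b ω ∂μ

/-- The infinite tensor product of the ψ_{ω x} need not be a vector of the configuration space, so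
the state is a weak-* limit of averaged vector states supported on finite Λ. On each local
observable these are constant once Λ is large enough, so the limit has the prescribed values there.
-/
lemma exists_isMixture [NeZero d] {ψ : ι → EuclideanSpace ℂ (Fin d)} (hψ : ∀ i, ‖ψ i‖ = 1)
    (μ : Measure (ℤ → ι)) [IsProbabilityMeasure μ] :
    ∃ φ : quasilocal d →L[ℂ] ℂ, IsMixture φ ψ μ := by
  let F : Finset ℤ → (ℤ → ι) → (quasilocal d →L[ℂ] ℂ) := fun Λ ω =>
    vectorFunctional (productVector ψ Λ ω)
  have hF : ∀ Λ, DependsOnLetters (F Λ) Λ := fun Λ =>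
    .of_congr fun _ _ h => by simp only [F, productVector_congr ψ h]
  let Φ : Finset ℤ → (quasilocal d →L[ℂ] ℂ) := fun Λ => ∫ ω, F Λ ω ∂μ
  have hΦ : ∀ Λ a, Φ Λ a = ∫ ω, F Λ ω a ∂μ := fun Λ a =>
    ContinuousLinearMap.integral_apply ((hF Λ).integrable μ) a
  have hv : ∀ Λ ω, ‖productVector ψ Λ ω‖ ^ 2 = 1 := fun Λ ω => by
    have h := inner_self_productVector hψ Λ ω
    rw [inner_self_eq_norm_sq_to_K, ← RCLike.ofReal_pow] at h
    exact Complex.ofReal_injective (h.trans Complex.ofReal_one.symm)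
  have hnorm : ∀ Λ, ‖Φ Λ‖ ≤ 1 := fun Λ => by
    have h := norm_integral_le_of_norm_le_const (μ := μ) (f := F Λ) (C := 1)
      (.of_forall fun ω => (norm_vectorFunctional_le _).trans (hv Λ ω).le)
    simpa using h
  -- An ultrafilter finer than `atTop` plays the role of a convergent subnet in the Banach–Alaoglu
  -- theorem.
  let U : Ultrafilter (Finset ℤ) := Ultrafilter.of atTop
  obtain ⟨φ, hφ, hlim⟩ := (WeakDual.isCompact_closedBall (𝕜 := ℂ) (E := quasilocal d) 0 1)
    |>.ultrafilter_le_nhds (U.map fun Λ => StrongDual.toWeakDual (Φ Λ)) (by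
      rw [le_principal_iff]
      exact Filter.mem_map.2 (Eventually.of_forall fun Λ => by simpa using hnorm Λ))
  have hlim' : ∀ a, Tendsto (fun Λ => Φ Λ a) U (𝓝 (φ a)) := fun a =>
    ((WeakDual.eval_continuous a).tendsto φ).comp hlim
  have hev : ∀ a c Λ₀, (∀ Λ, Λ₀ ⊆ Λ → Φ Λ a = c) → φ a = c := fun a c Λ₀ h => by
    refine tendsto_nhds_unique_of_eventuallyEq (hlim' a) tendsto_const_nhds ?_
    exact Ultrafilter.of_le _ ((eventually_ge_atTop Λ₀).mono fun Λ hΛ => h Λ hΛ)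
  refine ⟨WeakDual.toStrongDual φ, ⟨fun a => ?_, ?_⟩, by simpa using hφ, fun Λ a => ?_,
    fun Λ₁ Λ₂ a b hd => ?_⟩
  · refine ge_of_tendsto' (hlim' (star a * a)) fun Λ => ?_
    rw [hΦ]
    exact integral_nonneg fun ω => vectorFunctional_nonneg _ a
  · refine hev 1 1 ∅ fun Λ _ => ?_
    have h : ∀ ω, F Λ ω 1 = 1 := fun ω => inner_self_productVector hψ Λ ω
    simp [hΦ, h]
  · refine hev _ _ Λ fun Λ' h => ?_
    rw [hΦ]
    exact integral_congr_ae (.of_forall fun ω => inner_localOp_productVector hψ h ω a)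
  · refine hev _ _ (Λ₁ ∪ Λ₂) fun Λ' h => ?_
    rw [hΦ]
    exact integral_congr_ae (.of_forall fun ω => inner_localOp_mul_productVector hψ hd h ω a b)

end Mixture

/-! ## The quasilocal algebra and its states -/

section Quasilocal

variable {d : ℕ}

lemma localObs_induction {P : quasilocal d → Prop} (hP : IsClosed {a | P a})
    (h : ∀ Λ a, P (localObs Λ a)) (a : quasilocal d) : P a := by
  have hd : DenseRange fun p : (Σ Λ, LocalMatrix d Λ) => localObs p.1 p.2 := by
    rw [DenseRange, Subtype.dense_iff]
    intro T hT
    refine closure_mono ?_ hT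
    rintro _ ⟨Λ, b, rfl⟩
    exact ⟨localObs Λ b, ⟨⟨Λ, b⟩, rfl⟩, rfl⟩
  exact hd.induction_on a hP fun p => h p.1 p.2

lemma norm_shift_le (a : quasilocal d) : ‖shift d a‖ ≤ ‖a‖ := by
  refine ContinuousLinearMap.opNorm_le_bound _ (norm_nonneg _) fun f => ?_
  change ‖shiftUnitary d ((a : ConfigSpace d →L[ℂ] ConfigSpace d) ((shiftUnitary d).symm f))‖ ≤ _
  rw [LinearIsometryEquiv.norm_map, ← (shiftUnitary d).symm.norm_map f]
  exact (a : ConfigSpace d →L[ℂ] ConfigSpace d).le_opNorm _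

lemma norm_shift_iterate_le (n : ℕ) (a : quasilocal d) : ‖(shift d)^[n] a‖ ≤ ‖a‖ := by
  induction n with
  | zero => rfl
  | succ n ih =>
    rw [Function.iterate_succ_apply']
    exact (norm_shift_le _).trans ih

lemma continuous_shift : Continuous (shift d) :=
  AddMonoidHomClass.continuous_of_bound (shift d) 1 fun a => by simpa using norm_shift_le a

/-- Polarisation: φ is real on (a + c)*(a + c) and on a*a, so the cross terms have zero imaginary
part; c = 1 and c = i determine both parts of φ(a*). -/
lemma IsState.map_star {φ : quasilocal d →L[ℂ] ℂ} (hφ : IsState φ) (a : quasilocal d) :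
    φ (star a) = star (φ a) := by
  have key : ∀ c : ℂ, (c * φ (star a) + star c * φ a).im = 0 := fun c => by
    have h1 := (Complex.le_def.1 (hφ.nonneg (a + c • 1))).2
    have h2 := (Complex.le_def.1 (hφ.nonneg a)).2
    have h3 : φ (star (a + c • 1) * (a + c • 1)) =
        φ (star a * a) + (c * φ (star a) + star c * φ a) + star c * c := by
      have : star (a + c • (1 : quasilocal d)) * (a + c • 1) =
          star a * a + (c • star a + star c • a) + (star c * c) • 1 := by
        simp only [star_add, star_smul, star_one, add_mul, mul_add, smul_mul_assoc, one_mul,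
          mul_smul_comm, mul_one, smul_smul, mul_comm c (star c), smul_add]
        abel
      rw [this]
      simp [hφ.map_one]
    rw [h3] at h1
    simp only [Complex.add_im, Complex.zero_im] at h1 h2
    have h4 : (star c * c).im = 0 := by simp [mul_comm]
    rw [Complex.add_im]
    linarith
  have h1 := key 1
  have h2 := key Complex.I
  simp at h1 h2
  apply Complex.ext
  · simp; linarith
  · simp; linarith

/-- The variance φ((a − φ(a))*(a − φ(a))) = φ(a*a) − |φ(a)|² is nonnegative. -/
lemma IsState.sq_norm_le {φ : quasilocal d →L[ℂ] ℂ} (hφ : IsState φ) (a : quasilocal d) :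
    ‖φ a‖ ^ 2 ≤ (φ (star a * a)).re := by
  have h1 := (Complex.le_def.1 (hφ.nonneg (a - φ a • 1))).1
  have h3 : φ (star (a - φ a • 1) * (a - φ a • 1)) = φ (star a * a) - star (φ a) * φ a := by
    have : star (a - φ a • (1 : quasilocal d)) * (a - φ a • 1) =
        star a * a - φ a • star a - star (φ a) • a + (star (φ a) * φ a) • 1 := by
      simp only [star_sub, star_smul, star_one, sub_mul, mul_sub, smul_mul_assoc, one_mul,
        mul_smul_comm, mul_one, smul_sub, smul_smul, mul_comm (φ a)]
      abel
    rw [this]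
    simp only [map_sub, map_add, map_smul, hφ.map_one, hφ.map_star, smul_eq_mul]
    ring
  have h4 : star (φ a) * φ a = ((‖φ a‖ ^ 2 : ℝ) : ℂ) := by
    rw [Complex.star_def, Complex.conj_mul']
    norm_cast
  rw [h3, h4, Complex.sub_re, Complex.ofReal_re, Complex.zero_re] at h1
  linarith

end Quasilocal

/-! ## Densities and stationarity of mixtures -/

section Stationary

variable {d : ℕ} {ι : Type*}

lemma productSymbol_eq_trace (ψ : ι → EuclideanSpace ℂ (Fin d)) (Λ : Finset ℤ)
    (a : LocalMatrix d Λ) (ω : ℤ → ι) :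
    productSymbol ψ Λ a ω = ((tensorMatrix fun i : Λ => ketbra (ψ (ω i))) * a).trace := by
  simp only [productSymbol, Matrix.trace, Matrix.diag, Matrix.mul_apply, tensorMatrix,
    Matrix.of_apply, ketbra, Matrix.vecMulVec_apply, productWeight]
  rw [Finset.sum_comm]
  refine Finset.sum_congr rfl fun η _ => Finset.sum_congr rfl fun ζ _ => ?_
  rw [mul_comm]
  simp only [mul_comm]

lemma star_localObs (Λ : Finset ℤ) (a : LocalMatrix d Λ) :
    star (localObs Λ a) = localObs Λ (star a) :=
  Subtype.ext (localOp_star Λ a).symm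

lemma star_shift_iterate (n : ℕ) (a : quasilocal d) :
    star ((shift d)^[n] a) = (shift d)^[n] (star a) := by
  induction n with
  | zero => rfl
  | succ n ih => rw [Function.iterate_succ_apply', Function.iterate_succ_apply', ← ih, map_star]

lemma exists_disjoint_translates (Λ₁ Λ₂ : Finset ℤ) :
    ∃ R : ℕ, ∀ i j : ℤ, (R : ℤ) < |i - j| →
      Disjoint (Λ₁.map (addRightEmbedding i)) (Λ₂.map (addRightEmbedding j)) := by
  -- A common point x + i = y + j forces |i − j| = |y − x| ≤ |x| + |y|, which this crude sum
  -- dominates.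
  refine ⟨∑ x ∈ Λ₁, x.natAbs + ∑ x ∈ Λ₂, x.natAbs, fun i j h => ?_⟩
  rw [Finset.disjoint_left]
  intro z hz₁ hz₂
  obtain ⟨x, hx, rfl⟩ := Finset.mem_map.1 hz₁
  obtain ⟨y, hy, hxy⟩ := Finset.mem_map.1 hz₂
  have h1 := Finset.single_le_sum (f := Int.natAbs) (fun _ _ => Nat.zero_le _) hx
  have h2 := Finset.single_le_sum (f := Int.natAbs) (fun _ _ => Nat.zero_le _) hy
  simp only [addRightEmbedding_apply] at hxy
  rw [lt_abs] at h
  push_cast at h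
  zify at h1 h2
  have h3 := neg_abs_le x
  have h4 := le_abs_self x
  have h5 := neg_abs_le y
  have h6 := le_abs_self y
  rcases h with h | h <;> linarith

variable [Fintype ι] [MeasurableSpace ι] [DiscreteMeasurableSpace ι]
  {ψ : ι → EuclideanSpace ℂ (Fin d)} {μ : Measure (ℤ → ι)} {φ : quasilocal d →L[ℂ] ℂ}

lemma IsMixture.hasDensities [IsProbabilityMeasure μ] (hφ : IsMixture φ ψ μ) :
    HasDensities φ (clsSource ψ (wordProb μ)) := by
  intro m a
  rw [hφ.apply_localObs]
  simp only [productSymbol_eq_trace]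
  refine (integral_comp_restrict μ fun x : box m → ι =>
    ((tensorMatrix fun i : box m => ketbra (ψ (x i))) * a).trace).trans ?_
  simp only [clsSource, Finset.sum_mul, Matrix.trace_sum, Matrix.smul_mul, Matrix.trace_smul,
    smul_eq_mul, wordProb]

lemma integral_comp_measurePreserving {Ω : Type*} [MeasurableSpace Ω] {ν : Measure Ω}
    {T : Ω → Ω} (hT : MeasurePreserving T ν ν) {f : Ω → ℂ} (hf : StronglyMeasurable f) :
    ∫ ω, f (T ω) ∂ν = ∫ ω, f ω ∂ν := by
  conv_rhs => rw [← hT.map_eq]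
  exact (integral_map hT.measurable.aemeasurable hf.aestronglyMeasurable).symm

lemma IsMixture.isStationaryState (hφ : IsMixture φ ψ μ)
    (hT : MeasurePreserving (seqShift ι) μ μ) : IsStationaryState φ where
  toIsState := hφ.isState
  map_shift := localObs_induction
    (isClosed_eq (φ.continuous.comp continuous_shift) φ.continuous) fun Λ a => by
      rw [shift_localObs, hφ.apply_localObs, hφ.apply_localObs]
      simp only [productSymbol_shift]
      exact integral_comp_measurePreserving hT
        (dependsOnLetters_productSymbol ψ Λ a).stronglyMeasurable

lemma IsMixture.apply_shift_mul_shift {ι : Type*} [MeasurableSpace ι]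
    {ψ : ι → EuclideanSpace ℂ (Fin d)} {μ : Measure (ℤ → ι)} (hφ : IsMixture φ ψ μ) {Λ₁ Λ₂ : Finset ℤ}
    (a : LocalMatrix d Λ₁) (b : LocalMatrix d Λ₂) (i j : ℕ)
    (h : Disjoint (Λ₁.map (addRightEmbedding (i : ℤ))) (Λ₂.map (addRightEmbedding (j : ℤ)))) :
    φ ((shift d)^[i] (localObs Λ₁ a) * (shift d)^[j] (localObs Λ₂ b)) =
      ∫ ω, productSymbol ψ Λ₁ a ((seqShift ι)^[i] ω) *
        productSymbol ψ Λ₂ b ((seqShift ι)^[j] ω) ∂μ := by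
  obtain ⟨a', ha, ha'⟩ := exists_shift_iterate_localObs ψ Λ₁ a i
  obtain ⟨b', hb, hb'⟩ := exists_shift_iterate_localObs ψ Λ₂ b j
  rw [ha, hb, hφ.apply_mul _ _ _ _ h]
  simp only [ha', hb']

end Stationary

/-! ## Mixing of mixtures -/

section Mixing

/-- The constant K does not depend on n, so an approximation of the argument is uniform along the
sequence. -/
lemma isClosed_setOf_tendsto_zero {E : Type*} [SeminormedAddCommGroup E] {W : ℕ → E → ℝ} {K : ℝ}
    (h0 : ∀ n a, 0 ≤ W n a) (hW : ∀ n a b, W n a ≤ W n b + K * ‖a - b‖) :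
    IsClosed {a | Tendsto (fun n => W n a) atTop (𝓝 0)} := by
  refine isClosed_of_closure_subset fun a ha => ?_
  rw [Set.mem_ofPred_eq, Metric.tendsto_atTop]
  intro ε hε
  -- The added 1 keeps the radius positive and finite when K = 0.
  obtain ⟨b, hb, hab⟩ := Metric.mem_closure_iff.1 ha (ε / (2 * (|K| + 1))) (by positivity)
  obtain ⟨N, hN⟩ := Metric.tendsto_atTop.1 hb (ε / 2) (by positivity)
  refine ⟨N, fun n hn => ?_⟩
  have h1 := hN n hn
  rw [Real.dist_0_eq_abs, abs_of_nonneg (h0 _ _)] at h1 ⊢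
  rw [dist_eq_norm, lt_div_iff₀ (by positivity)] at hab
  have h2 : K * ‖a - b‖ ≤ |K| * ‖a - b‖ := by
    gcongr
    exact le_abs_self K
  have h3 := hW n a b
  nlinarith [norm_nonneg (a - b)]

variable {d : ℕ}

/-- The correlation of `a` with the `i`-th translate of `b`. -/
def correlation (φ : quasilocal d →L[ℂ] ℂ) (i : ℕ) (a b : quasilocal d) : ℂ :=
  φ (a * (shift d)^[i] b) - φ a * φ b

lemma norm_correlation_le {φ : quasilocal d →L[ℂ] ℂ} (hφ : ‖φ‖ ≤ 1) (i : ℕ)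
    (a b : quasilocal d) : ‖correlation φ i a b‖ ≤ 2 * ‖a‖ * ‖b‖ := by
  have h : ∀ c, ‖φ c‖ ≤ ‖c‖ := fun c => φ.le_of_opNorm_le hφ c |>.trans (one_mul _).le
  have h1 : ‖φ (a * (shift d)^[i] b)‖ ≤ ‖a‖ * ‖b‖ :=
    (h _).trans ((norm_mul_le _ _).trans (by gcongr; exact norm_shift_iterate_le i b))
  have h2 : ‖φ a * φ b‖ ≤ ‖a‖ * ‖b‖ := by
    rw [norm_mul]
    exact mul_le_mul (h a) (h b) (norm_nonneg _) (norm_nonneg _)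
  calc ‖correlation φ i a b‖ ≤ ‖φ (a * (shift d)^[i] b)‖ + ‖φ a * φ b‖ := norm_sub_le _ _
    _ ≤ 2 * ‖a‖ * ‖b‖ := by linarith

lemma norm_correlation_le_left {φ : quasilocal d →L[ℂ] ℂ} (hφ : ‖φ‖ ≤ 1) (i : ℕ)
    (a a' b : quasilocal d) :
    ‖correlation φ i a b‖ ≤ ‖correlation φ i a' b‖ + 2 * ‖b‖ * ‖a - a'‖ := by
  have h : correlation φ i a b = correlation φ i a' b + correlation φ i (a - a') b := by
    simp only [correlation, sub_mul, map_sub]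
    ring
  rw [h]
  exact (norm_add_le _ _).trans (by
    gcongr
    exact (norm_correlation_le hφ i _ _).trans (by rw [mul_right_comm]))

lemma norm_correlation_le_right {φ : quasilocal d →L[ℂ] ℂ} (hφ : ‖φ‖ ≤ 1) (i : ℕ)
    (a b b' : quasilocal d) :
    ‖correlation φ i a b‖ ≤ ‖correlation φ i a b'‖ + 2 * ‖a‖ * ‖b - b'‖ := by
  have h : correlation φ i a b = correlation φ i a b' + correlation φ i a (b - b') := by
    simp only [correlation, iterate_map_sub, mul_sub, map_sub]
    ring
  rw [h]
  exact (norm_add_le _ _).trans (by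
    gcongr
    exact norm_correlation_le hφ i _ _)

/-- A sequence of means `M`, applied to the moduli of the correlations, tends to zero as soon as it
does so for local observables. -/
lemma tendsto_mean_correlation {φ : quasilocal d →L[ℂ] ℂ} (hφ : ‖φ‖ ≤ 1)
    (M : ℕ → (ℕ → ℝ) → ℝ) (hM0 : ∀ n u, (∀ i, 0 ≤ u i) → 0 ≤ M n u)
    (hM : ∀ n u v c, 0 ≤ c → (∀ i, u i ≤ v i + c) → M n u ≤ M n v + c)
    (hloc : ∀ Λ₁ Λ₂ a b, Tendsto
      (fun n => M n fun i => ‖correlation φ i (localObs Λ₁ a) (localObs Λ₂ b)‖) atTop (𝓝 0))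
    (a b : quasilocal d) :
    Tendsto (fun n => M n fun i => ‖correlation φ i a b‖) atTop (𝓝 0) := by
  -- The arguments are freed one at a time: the Lipschitz constant in one of them is twice the norm
  -- of the other, so the fixed one may be arbitrary.
  have h1 : ∀ (Λ : Finset ℤ) (a₀ : LocalMatrix d Λ) (b : quasilocal d),
      Tendsto (fun n => M n fun i => ‖correlation φ i (localObs Λ a₀) b‖) atTop (𝓝 0) :=
    fun Λ a₀ => localObs_induction (isClosed_setOf_tendsto_zero
      (W := fun n b => M n fun i => ‖correlation φ i (localObs Λ a₀) b‖)
      (K := 2 * ‖localObs Λ a₀‖) (fun n b => hM0 _ _ fun _ => norm_nonneg _)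
      fun n b b' => hM _ _ _ _ (by positivity) fun i => norm_correlation_le_right hφ i _ _ _)
      fun Λ' b₀ => hloc Λ Λ' a₀ b₀
  exact localObs_induction (P := fun a =>
    Tendsto (fun n => M n fun i => ‖correlation φ i a b‖) atTop (𝓝 0))
    (isClosed_setOf_tendsto_zero
      (W := fun n a => M n fun i => ‖correlation φ i a b‖)
      (K := 2 * ‖b‖) (fun n a => hM0 _ _ fun _ => norm_nonneg _)
      fun n a a' => hM _ _ _ _ (by positivity) fun i => norm_correlation_le_left hφ i _ _ _)
    (fun Λ a₀ => h1 Λ a₀ b) a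

/-- The cylinder of all sequences with the letters `x` in `Λ`. -/
def cylinder {ι : Type*} (Λ : Finset ℤ) (x : Λ → ι) : Set (ℤ → ι) :=
  {ω | ∀ i : Λ, ω i = x i}

lemma mem_cylinder_iff {ι : Type*} {Λ : Finset ℤ} {x : Λ → ι} {ω : ℤ → ι} :
    ω ∈ cylinder Λ x ↔ Λ.restrict ω = x :=
  funext_iff.symm

lemma comp_restrict_eq_sum_indicator {ι : Type*} [Fintype ι] {Λ : Finset ℤ} (g : (Λ → ι) → ℂ)
    (ω : ℤ → ι) :
    g (Λ.restrict ω) = ∑ x, g x * (cylinder Λ x).indicator (fun _ => 1) ω := by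
  classical
  rw [Finset.sum_eq_single (Λ.restrict ω)]
  · rw [Set.indicator_of_mem (mem_cylinder_iff.2 rfl), mul_one]
  · intro x _ hx
    rw [Set.indicator_of_notMem (fun h => hx (mem_cylinder_iff.1 h).symm), mul_zero]
  · simp

variable {ι : Type*} [Fintype ι] [MeasurableSpace ι] [DiscreteMeasurableSpace ι]

lemma measurableSet_cylinder (Λ : Finset ℤ) (x : Λ → ι) : MeasurableSet (cylinder Λ x) := by
  have h : cylinder Λ x = Λ.restrict (π := fun _ => ι) ⁻¹' {x} := Set.ext fun _ => mem_cylinder_iff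
  exact h ▸ Finset.measurable_restrict Λ (measurableSet_singleton x)

lemma integral_comp_restrict_eq_sum_cylinder (μ : Measure (ℤ → ι)) [IsFiniteMeasure μ]
    {Λ : Finset ℤ} (g : (Λ → ι) → ℂ) :
    ∫ ω, g (Λ.restrict ω) ∂μ = ∑ x, g x * (μ.real (cylinder Λ x) : ℂ) := by
  simp only [integral_comp_restrict, mul_comm (g _), cylinder]

lemma integral_mul_comp_iterate (μ : Measure (ℤ → ι)) [IsFiniteMeasure μ] {Λ₁ Λ₂ : Finset ℤ}
    (g : (Λ₁ → ι) → ℂ) (h : (Λ₂ → ι) → ℂ) {T : (ℤ → ι) → ℤ → ι} (hT : Measurable T) :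
    ∫ ω, g (Λ₁.restrict ω) * h (Λ₂.restrict (T ω)) ∂μ =
      ∑ x, ∑ y, g x * h y * (μ.real (cylinder Λ₁ x ∩ T ⁻¹' cylinder Λ₂ y) : ℂ) := by
  have hm : ∀ x y, MeasurableSet (cylinder Λ₁ x ∩ T ⁻¹' cylinder Λ₂ y) := fun x y =>
    (measurableSet_cylinder Λ₁ x).inter (hT (measurableSet_cylinder Λ₂ y))
  have hint : ∀ x y, Integrable (fun ω => g x * h y *
      (cylinder Λ₁ x ∩ T ⁻¹' cylinder Λ₂ y).indicator (fun _ => (1 : ℂ)) ω) μ := fun x y =>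
    ((integrable_const (1 : ℂ)).indicator (hm x y)).const_mul _
  have hpt : ∀ ω, g (Λ₁.restrict ω) * h (Λ₂.restrict (T ω)) = ∑ x, ∑ y, g x * h y *
      (cylinder Λ₁ x ∩ T ⁻¹' cylinder Λ₂ y).indicator (fun _ => (1 : ℂ)) ω := fun ω => by
    rw [comp_restrict_eq_sum_indicator g, comp_restrict_eq_sum_indicator h, Finset.sum_mul_sum]
    refine Finset.sum_congr rfl fun x _ => Finset.sum_congr rfl fun y _ => ?_
    by_cases h1 : ω ∈ cylinder Λ₁ x <;> by_cases h2 : T ω ∈ cylinder Λ₂ y <;> simp [h1, h2]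
  simp only [hpt]
  rw [integral_finsetSum _ fun x _ => integrable_finsetSum _ fun y _ => hint x y]
  refine Finset.sum_congr rfl fun x _ => ?_
  rw [integral_finsetSum _ fun y _ => hint x y]
  refine Finset.sum_congr rfl fun y _ => ?_
  rw [integral_const_mul, integral_indicator_const _ (hm x y)]
  simp

variable {ψ : ι → EuclideanSpace ℂ (Fin d)} {μ : Measure (ℤ → ι)} {φ : quasilocal d →L[ℂ] ℂ}

/-- The correlations of local observables are eventually controlled by finitely many classical
ones. -/
lemma IsMixture.exists_correlation_le [IsProbabilityMeasure μ] (hφ : IsMixture φ ψ μ)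
    (hT : Measurable (seqShift ι)) (Λ₁ Λ₂ : Finset ℤ) (a : LocalMatrix d Λ₁)
    (b : LocalMatrix d Λ₂) :
    ∃ (c : (Λ₁ → ι) → (Λ₂ → ι) → ℝ) (R : ℕ), (∀ x y, 0 ≤ c x y) ∧ ∀ i, R < i →
      ‖correlation φ i (localObs Λ₁ a) (localObs Λ₂ b)‖ ≤ ∑ x, ∑ y, c x y *
        |μ.real (cylinder Λ₁ x ∩ (seqShift ι)^[i] ⁻¹' cylinder Λ₂ y) -
          μ.real (cylinder Λ₁ x) * μ.real (cylinder Λ₂ y)| := by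
  obtain ⟨g, hg⟩ := dependsOnLetters_productSymbol ψ Λ₁ a
  obtain ⟨h, hh⟩ := dependsOnLetters_productSymbol ψ Λ₂ b
  obtain ⟨R, hR⟩ := exists_disjoint_translates Λ₁ Λ₂
  refine ⟨fun x y => ‖g x * h y‖, R, fun _ _ => norm_nonneg _, fun i hi => ?_⟩
  -- Beyond R the region Λ₁ and the translate of Λ₂ are disjoint, so the quantum correlation becomes
  -- an integral of a product of symbols.
  have hd := hR 0 i (by
    rw [zero_sub, abs_neg, Nat.abs_cast]
    exact_mod_cast hi)
  have h1 := hφ.apply_shift_mul_shift a b 0 i (by exact_mod_cast hd)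
  have h2 : correlation φ i (localObs Λ₁ a) (localObs Λ₂ b) = ∑ x, ∑ y, g x * h y *
      ((μ.real (cylinder Λ₁ x ∩ (seqShift ι)^[i] ⁻¹' cylinder Λ₂ y) -
          μ.real (cylinder Λ₁ x) * μ.real (cylinder Λ₂ y) : ℝ) : ℂ) := by
    simp only [Function.iterate_zero, id] at h1
    rw [correlation, h1, hφ.apply_localObs, hφ.apply_localObs, hg, hh]
    simp only [Function.comp_apply]
    rw [integral_mul_comp_iterate μ g h (hT.iterate i), integral_comp_restrict_eq_sum_cylinder,
      integral_comp_restrict_eq_sum_cylinder, Finset.sum_mul_sum, ← Finset.sum_sub_distrib]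
    refine Finset.sum_congr rfl fun x _ => ?_
    rw [← Finset.sum_sub_distrib]
    refine Finset.sum_congr rfl fun y _ => ?_
    push_cast
    ring
  rw [h2]
  refine (norm_sum_le _ _).trans (Finset.sum_le_sum fun x _ => (norm_sum_le _ _).trans
    (Finset.sum_le_sum fun y _ => ?_))
  rw [norm_mul, Complex.norm_real, Real.norm_eq_abs]

lemma IsMixture.isStronglyMixingState [IsProbabilityMeasure μ] (hφ : IsMixture φ ψ μ)
    (hT : IsStronglyMixing (seqShift ι) μ) : IsStronglyMixingState φ where
  toIsStationaryState := hφ.isStationaryState hT.toMeasurePreserving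
  tendsto a b := by
    -- Strong mixing is the case in which the n-th mean is evaluation at n.
    have h := tendsto_mean_correlation hφ.norm_le (fun n u => u n) (fun n u hu => hu n)
      (fun n u v c _ h => h n) (fun Λ₁ Λ₂ a b => ?_) a b
    · exact tendsto_iff_norm_sub_tendsto_zero.2 h
    · obtain ⟨c, R, hc, hR⟩ := hφ.exists_correlation_le hT.measurable Λ₁ Λ₂ a b
      refine squeeze_zero' (.of_forall fun _ => norm_nonneg _)
        ((eventually_gt_atTop R).mono hR) ?_
      rw [show (0 : ℝ) = ∑ x, ∑ y, c x y * 0 by simp]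
      refine tendsto_finsetSum _ fun x _ => tendsto_finsetSum _ fun y _ => ?_
      refine Tendsto.const_mul _ ?_
      exact tendsto_iff_norm_sub_tendsto_zero.1 (hT.tendsto _ _ (measurableSet_cylinder Λ₁ x)
        (measurableSet_cylinder Λ₂ y))

lemma IsMixture.isWeaklyMixingState [IsProbabilityMeasure μ] (hφ : IsMixture φ ψ μ)
    (hT : IsWeaklyMixing (seqShift ι) μ) : IsWeaklyMixingState φ where
  toIsStationaryState := hφ.isStationaryState hT.toMeasurePreserving
  tendsto a b := by
    refine tendsto_mean_correlation hφ.norm_le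
      (fun n u => (n : ℝ)⁻¹ * ∑ i ∈ Finset.Icc 1 n, u i)
      (fun n u hu => mul_nonneg (by positivity) (Finset.sum_nonneg fun i _ => hu i))
      (fun n u v c hc h => ?_) (fun Λ₁ Λ₂ a b => ?_) a b
    -- For n = 0 the convention 0⁻¹ = 0 makes both means vanish, leaving 0 ≤ c.
    · rcases Nat.eq_zero_or_pos n with rfl | hn
      · simpa using hc
      · have hn' : (n : ℝ) ≠ 0 := by positivity
        calc (n : ℝ)⁻¹ * ∑ i ∈ Finset.Icc 1 n, u i
            ≤ (n : ℝ)⁻¹ * ∑ i ∈ Finset.Icc 1 n, (v i + c) := by gcongr; exact h _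
          _ = (n : ℝ)⁻¹ * ∑ i ∈ Finset.Icc 1 n, v i + c := by
            rw [Finset.sum_add_distrib]
            simp [mul_add, hn']
    · obtain ⟨c, R, hc, hR⟩ := hφ.exists_correlation_le hT.measurable Λ₁ Λ₂ a b
      set u : ℕ → ℝ := fun i => ‖correlation φ i (localObs Λ₁ a) (localObs Λ₂ b)‖
      set C : ℝ := 2 * ‖localObs Λ₁ a‖ * ‖localObs Λ₂ b‖
      have hC : 0 ≤ C := by positivity
      have huC : ∀ i, u i ≤ C := fun i => norm_correlation_le hφ.norm_le i _ _
      let e : (Λ₁ → ι) → (Λ₂ → ι) → ℕ → ℝ := fun x y i =>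
        |μ.real (cylinder Λ₁ x ∩ (seqShift ι)^[i] ⁻¹' cylinder Λ₂ y) -
          μ.real (cylinder Λ₁ x) * μ.real (cylinder Λ₂ y)|
      -- The displacements i ≤ R, where the regions may overlap, get the trivial bound C. Together
      -- they add at most (R + 1)C to the sum, which the factor 1/n sends to 0.
      have hpt : ∀ i, u i ≤ (∑ x, ∑ y, c x y * e x y i) + if i ∈ Finset.range (R + 1) then C else 0 :=
        fun i => by
          have hr : 0 ≤ ∑ x, ∑ y, c x y * e x y i := Finset.sum_nonneg fun x _ =>
            Finset.sum_nonneg fun y _ => mul_nonneg (hc x y) (abs_nonneg _)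
          split_ifs with hi
          · linarith [huC i]
          · rw [add_zero]
            exact hR i (by simpa using hi)
      have hsum : ∀ n, ∑ i ∈ Finset.Icc 1 n, u i ≤
          (∑ x, ∑ y, c x y * ∑ i ∈ Finset.Icc 1 n, e x y i) + (R + 1) * C := fun n => by
        refine (Finset.sum_le_sum fun i _ => hpt i).trans ?_
        rw [Finset.sum_add_distrib]
        refine add_le_add (le_of_eq ?_) ?_
        · rw [Finset.sum_comm]
          refine Finset.sum_congr rfl fun x _ => ?_
          rw [Finset.sum_comm]
          exact Finset.sum_congr rfl fun y _ => (Finset.mul_sum _ _ _).symm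
        · rw [← Finset.sum_filter, Finset.sum_const, nsmul_eq_mul]
          gcongr
          calc ((Finset.filter (· ∈ Finset.range (R + 1)) (Finset.Icc 1 n)).card : ℝ)
              ≤ ((Finset.range (R + 1)).card : ℝ) := by
                gcongr
                exact fun i hi => (Finset.mem_filter.1 hi).2
            _ = R + 1 := by simp
      have hlim : Tendsto (fun n : ℕ => (∑ x, ∑ y, c x y * ((n : ℝ)⁻¹ *
          ∑ i ∈ Finset.Icc 1 n, e x y i)) + (n : ℝ)⁻¹ * ((R + 1) * C)) atTop (𝓝 0) := by
        rw [show (0 : ℝ) = (∑ x : Λ₁ → ι, ∑ y : Λ₂ → ι, c x y * 0) + 0 * ((R + 1) * C) by simp]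
        refine Tendsto.add (tendsto_finsetSum _ fun x _ => tendsto_finsetSum _ fun y _ =>
          Tendsto.const_mul _ ?_) (tendsto_inv_atTop_nhds_zero_nat.mul_const _)
        exact hT.tendsto _ _ (measurableSet_cylinder Λ₁ x) (measurableSet_cylinder Λ₂ y)
      refine squeeze_zero (fun n => mul_nonneg (by positivity) (Finset.sum_nonneg fun i _ =>
        norm_nonneg _)) (fun n => ?_) hlim
      refine (mul_le_mul_of_nonneg_left (hsum n) (by positivity)).trans (le_of_eq ?_)
      simp only [mul_add, Finset.mul_sum, mul_left_comm]

end Mixing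

/-! ## The mean ergodic theorem for an ergodic map -/

section MeanErgodic

variable {Ω : Type*} [MeasurableSpace Ω] {μ : Measure Ω} {T : Ω → Ω}

/-- Identifies the Birkhoff sums of the Koopman operator on L² with the classes of the pointwise
Birkhoff sums of T. The membership proof is part of the claim so that the induction can carry it
along. -/
lemma exists_birkhoffSum_eq_toLp (hT : MeasurePreserving T μ μ) {f : Ω → ℂ} (hf : MemLp f 2 μ)
    (n : ℕ) : ∃ h : MemLp (birkhoffSum T f n) 2 μ,
      birkhoffSum (Lp.compMeasurePreservingₗᵢ ℂ T hT (p := 2) (E := ℂ)) id n (hf.toLp f) =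
        h.toLp _ := by
  have hiter : ∀ n, (Lp.compMeasurePreservingₗᵢ ℂ T hT (p := 2) (E := ℂ))^[n] (hf.toLp f) =
      (hf.comp_measurePreserving (hT.iterate n)).toLp (f ∘ T^[n]) := fun n => by
    induction n with
    | zero => rfl
    | succ n ih =>
      rw [Function.iterate_succ_apply', ih]
      rfl
  induction n with
  | zero =>
    have h0 : birkhoffSum T f 0 = 0 := birkhoffSum_zero' T f
    rw [h0, birkhoffSum_zero]
    exact ⟨MemLp.zero, (MemLp.toLp_zero _).symm⟩
  | succ n ih =>
    obtain ⟨h, ih⟩ := ih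
    have hs : birkhoffSum T f (n + 1) = birkhoffSum T f n + f ∘ T^[n] :=
      funext fun ω => birkhoffSum_succ T f n ω
    rw [hs, birkhoffSum_succ, ih, hiter]
    exact ⟨h.add (hf.comp_measurePreserving (hT.iterate n)), (MemLp.toLp_add _ _).symm⟩

/-- The time averages of a centred function tend to zero in mean square. -/
lemma tendsto_integral_birkhoffAverage_sq [IsProbabilityMeasure μ] (hT : Ergodic T μ)
    {f : Ω → ℂ} (hf : MemLp f 2 μ) (hf0 : ∫ ω, f ω ∂μ = 0) :
    Tendsto (fun n => ∫ ω, star (birkhoffAverage ℂ T f n ω) * birkhoffAverage ℂ T f n ω ∂μ)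
      atTop (𝓝 0) := by
  let U := Lp.compMeasurePreservingₗᵢ ℂ T hT.toMeasurePreserving (p := 2) (E := ℂ)
  let V : Lp ℂ 2 μ →L[ℂ] Lp ℂ 2 μ := U.toContinuousLinearMap
  -- Von Neumann's theorem for the Koopman isometry: the averages converge to the projection y onto
  -- the invariant functions.
  have hlim := V.tendsto_birkhoffAverage_orthogonalProjection
    U.norm_toContinuousLinearMap_le (hf.toLp f)
  set y := (V.eqLocus (1 : Lp ℂ 2 μ →L[ℂ] Lp ℂ 2 μ)).orthogonalProjectionOnto (hf.toLp f) with hy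
  have hyfix : Lp.compMeasurePreserving T hT.toMeasurePreserving (y : Lp ℂ 2 μ) = y := y.2
  obtain ⟨c, hc⟩ := hT.ae_eq_const_of_ae_eq_comp_ae (Lp.aestronglyMeasurable (y : Lp ℂ 2 μ))
    ((Lp.coeFn_compMeasurePreserving _ hT.toMeasurePreserving).symm.trans
      (by rw [hyfix]))
  -- By ergodicity y is a constant c, and ⟨y, y⟩ = ⟨y, f⟩ = c̄ ∫ f = 0.
  have hy0 : y = 0 := by
    rw [← inner_self_eq_zero (𝕜 := ℂ)]
    nth_rw 2 [hy]
    rw [Submodule.inner_orthogonalProjectionOnto_eq_of_mem_left, L2.inner_def]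
    calc ∫ ω, ⟪(y : Lp ℂ 2 μ) ω, hf.toLp f ω⟫_ℂ ∂μ = ∫ ω, star c * f ω ∂μ := by
          refine integral_congr_ae ?_
          filter_upwards [hc, hf.coeFn_toLp] with ω h1 h2
          rw [h1, h2, RCLike.inner_apply, mul_comm]
          rfl
      _ = 0 := by rw [integral_const_mul, hf0, mul_zero]
  rw [hy0] at hlim
  have hlim2 := hlim.inner (𝕜 := ℂ) hlim
  rw [Submodule.coe_zero, inner_zero_left] at hlim2
  refine hlim2.congr fun n => ?_
  obtain ⟨h, hn⟩ := exists_birkhoffSum_eq_toLp hT.toMeasurePreserving hf n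
  have hn' : birkhoffAverage ℂ V id n (hf.toLp f) = (n : ℂ)⁻¹ • h.toLp _ :=
    congrArg ((n : ℂ)⁻¹ • ·) hn
  rw [hn', L2.inner_def]
  refine integral_congr_ae ?_
  filter_upwards [Lp.coeFn_smul (n : ℂ)⁻¹ (h.toLp _), h.coeFn_toLp] with ω h1 h2
  rw [h1, Pi.smul_apply, h2, RCLike.inner_apply, mul_comm]
  rfl

end MeanErgodic

/-! ## Ergodicity of mixtures -/

section Ergodic

variable {d : ℕ} {ι : Type*} [Fintype ι] [MeasurableSpace ι] [DiscreteMeasurableSpace ι]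
  {ψ : ι → EuclideanSpace ℂ (Fin d)} {μ : Measure (ℤ → ι)} {φ : quasilocal d →L[ℂ] ℂ}

/-- Stated for a general star algebra so that it expands both the quantum mean square in the
quasilocal algebra and the classical one in ℂ. -/
lemma star_birkhoffAverage_mul_self {R : Type*} [Semiring R] [StarRing R] [Algebra ℂ R]
    [StarModule ℂ R] {α : Type*} (T : α → α) (f : α → R) (n : ℕ) (x : α) :
    star (birkhoffAverage ℂ T f n x) * birkhoffAverage ℂ T f n x =
      ((n : ℂ)⁻¹ * (n : ℂ)⁻¹) • ∑ i ∈ Finset.range n, ∑ j ∈ Finset.range n,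
        star (f (T^[i] x)) * f (T^[j] x) := by
  have h : star (n : ℂ)⁻¹ = (n : ℂ)⁻¹ := by simp
  rw [birkhoffAverage, birkhoffSum, star_smul, h, smul_mul_smul_comm, star_sum,
    Finset.sum_mul_sum]

lemma card_near_le (n R i : ℕ) :
    ((Finset.range n).filter fun j : ℕ => |(i : ℤ) - j| ≤ R).card ≤ 2 * R + 1 := by
  calc ((Finset.range n).filter fun j : ℕ => |(i : ℤ) - j| ≤ R).card
      ≤ (Finset.Icc (i - R) (i + R)).card := by
        -- The subtraction i − R is truncated at 0, which loses no natural number j.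
        refine Finset.card_le_card fun j hj => ?_
        have h := abs_le.1 (Finset.mem_filter.1 hj).2
        rw [Finset.mem_Icc]
        omega
    _ ≤ 2 * R + 1 := by
        rw [Nat.card_Icc]
        omega

/-- The mean square of the time averages of a centred local observable tends to zero. -/
lemma IsMixture.tendsto_birkhoffAverage [NeZero d] [IsProbabilityMeasure μ]
    (hψ : ∀ i, ‖ψ i‖ = 1) (hφ : IsMixture φ ψ μ) (hT : Ergodic (seqShift ι) μ) (Λ : Finset ℤ)
    (b : LocalMatrix d Λ) (hb : φ (localObs Λ b) = 0) :
    Tendsto (fun n => φ (star (birkhoffAverage ℂ (shift d) id n (localObs Λ b)) *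
      birkhoffAverage ℂ (shift d) id n (localObs Λ b))) atTop (𝓝 0) := by
  set T := seqShift ι with hTdef
  set f := productSymbol ψ Λ b with hf
  have hfd : DependsOnLetters f Λ := dependsOnLetters_productSymbol ψ Λ b
  obtain ⟨C, hC0, hC⟩ := hfd.exists_bound
  obtain ⟨R, hR⟩ := exists_disjoint_translates Λ Λ
  have hf0 : ∫ ω, f ω ∂μ = 0 := by rw [← hb, hφ.apply_localObs]
  have hlim := tendsto_integral_birkhoffAverage_sq hT (hfd.memLp 2 μ) hf0
  -- P and Q are the quantum and classical two-time correlations. They agree whenever |i − j| > R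
  -- and differ by at most M in the remaining band.
  let P : ℕ → ℕ → ℂ := fun i j =>
    φ (star ((shift d)^[i] (localObs Λ b)) * (shift d)^[j] (localObs Λ b))
  let Q : ℕ → ℕ → ℂ := fun i j => ∫ ω, star (f (T^[i] ω)) * f (T^[j] ω) ∂μ
  have hmeas : ∀ i, StronglyMeasurable fun ω => f (T^[i] ω) := fun i =>
    hfd.stronglyMeasurable.comp_measurable (hT.measurable.iterate i)
  have hQint : ∀ i j, Integrable (fun ω => star (f (T^[i] ω)) * f (T^[j] ω)) μ := fun i j => by
    refine Integrable.of_bound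
      ((continuous_star.comp_stronglyMeasurable (hmeas i)).mul (hmeas j)).aestronglyMeasurable
      (C * C) (.of_forall fun ω => ?_)
    rw [norm_mul, norm_star]
    exact mul_le_mul (hC _) (hC _) (norm_nonneg _) hC0
  set M : ℝ := ‖localObs Λ b‖ * ‖localObs Λ b‖ + C * C with hM
  have hM0 : 0 ≤ M := by positivity
  have hPQ : ∀ i j : ℕ, ‖P i j - Q i j‖ ≤ if |(i : ℤ) - j| ≤ R then M else 0 := fun i j => by
    split_ifs with h
    · refine (norm_sub_le _ _).trans (add_le_add ?_ ?_)
      · refine (φ.le_of_opNorm_le hφ.norm_le _).trans ?_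
        rw [one_mul]
        refine (norm_mul_le _ _).trans ?_
        rw [show ‖star ((shift d)^[i] (localObs Λ b))‖ = ‖(shift d)^[i] (localObs Λ b)‖ from
          norm_star ((shift d)^[i] (localObs Λ b) : ConfigSpace d →L[ℂ] ConfigSpace d)]
        exact mul_le_mul (norm_shift_iterate_le i _) (norm_shift_iterate_le j _)
          (norm_nonneg _) (norm_nonneg _)
      · have h := norm_integral_le_of_norm_le_const (μ := μ)
          (f := fun ω => star (f (T^[i] ω)) * f (T^[j] ω)) (C := C * C) (.of_forall fun ω => by
            rw [norm_mul, norm_star]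
            exact mul_le_mul (hC _) (hC _) (norm_nonneg _) hC0)
        simpa [Q] using h
    · have hd := hR i j (not_le.1 h)
      have : P i j = Q i j := by
        simp only [P, Q]
        rw [star_shift_iterate, star_localObs, hφ.apply_shift_mul_shift _ _ i j hd]
        simp only [productSymbol_star hψ, ← hf, ← hTdef]
      rw [this, sub_self, norm_zero]
  have hP : ∀ n, φ (star (birkhoffAverage ℂ (shift d) id n (localObs Λ b)) *
      birkhoffAverage ℂ (shift d) id n (localObs Λ b)) = ((n : ℂ)⁻¹ * (n : ℂ)⁻¹) *
        ∑ i ∈ Finset.range n, ∑ j ∈ Finset.range n, P i j := fun n => by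
    rw [star_birkhoffAverage_mul_self, map_smul, smul_eq_mul, map_sum]
    simp only [map_sum]
    rfl
  have hQ : ∀ n, ∫ ω, star (birkhoffAverage ℂ T f n ω) * birkhoffAverage ℂ T f n ω ∂μ =
      ((n : ℂ)⁻¹ * (n : ℂ)⁻¹) * ∑ i ∈ Finset.range n, ∑ j ∈ Finset.range n, Q i j := fun n => by
    simp only [star_birkhoffAverage_mul_self, smul_eq_mul]
    rw [integral_const_mul, integral_finsetSum _ fun i _ => integrable_finsetSum _ fun j _ =>
      hQint i j]
    simp only [integral_finsetSum _ fun j _ => hQint _ j]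
    rfl
  -- Each of the n rows has at most 2R + 1 entries in the band, so after division by n² the two mean
  -- squares differ by at most (2R + 1)M/n.
  have hdiff : Tendsto (fun n => φ (star (birkhoffAverage ℂ (shift d) id n (localObs Λ b)) *
      birkhoffAverage ℂ (shift d) id n (localObs Λ b)) -
        ∫ ω, star (birkhoffAverage ℂ T f n ω) * birkhoffAverage ℂ T f n ω ∂μ) atTop (𝓝 0) := by
    have hzero := tendsto_inv_atTop_nhds_zero_nat (𝕜 := ℝ) |>.mul_const ((2 * R + 1) * M)
    rw [zero_mul] at hzero
    refine squeeze_zero_norm (fun n => ?_) hzero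
    rw [hP, hQ, ← mul_sub, ← Finset.sum_sub_distrib, norm_mul, norm_mul, norm_inv,
      Complex.norm_natCast]
    simp only [← Finset.sum_sub_distrib]
    have hsum : ‖∑ i ∈ Finset.range n, ∑ j ∈ Finset.range n, (P i j - Q i j)‖ ≤
        n * ((2 * R + 1) * M) := by
      calc ‖∑ i ∈ Finset.range n, ∑ j ∈ Finset.range n, (P i j - Q i j)‖
          ≤ ∑ i ∈ Finset.range n, ((2 * R + 1) * M) := by
            refine norm_sum_le_of_le _ fun i _ => ?_
            refine (norm_sum_le_of_le _ fun j _ => hPQ i j).trans ?_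
            rw [← Finset.sum_filter, Finset.sum_const, nsmul_eq_mul]
            gcongr
            exact_mod_cast card_near_le n R i
        _ = n * ((2 * R + 1) * M) := by simp
    rcases Nat.eq_zero_or_pos n with rfl | hn
    · simp
    · have hn' : (n : ℝ) ≠ 0 := by positivity
      calc (n : ℝ)⁻¹ * (n : ℝ)⁻¹ * ‖∑ i ∈ Finset.range n, ∑ j ∈ Finset.range n, (P i j - Q i j)‖
          ≤ (n : ℝ)⁻¹ * (n : ℝ)⁻¹ * (n * ((2 * R + 1) * M)) := by gcongr
        _ = (n : ℝ)⁻¹ * ((2 * R + 1) * M) := by field_simp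
  have := hdiff.add hlim
  simpa using this

lemma IsStationaryState.apply_birkhoffAverage {χ : quasilocal d →L[ℂ] ℂ}
    (hχ : IsStationaryState χ) {n : ℕ} (hn : n ≠ 0) (a : quasilocal d) :
    χ (birkhoffAverage ℂ (shift d) id n a) = χ a := by
  have hiter : ∀ i, χ ((shift d)^[i] a) = χ a := fun i => by
    induction i with
    | zero => rfl
    | succ i ih => rw [Function.iterate_succ_apply', hχ.map_shift, ih]
  have hn' : (n : ℂ) ≠ 0 := by exact_mod_cast hn
  rw [birkhoffAverage, birkhoffSum, map_smul, map_sum]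
  simp [hiter, hn']

/-- A stationary χ₁ occurring in φ with weight t > 0 satisfies χ₁ ≤ t⁻¹φ on positive elements, so
vanishing quantum mean squares for φ force χ₁ to annihilate every local observable annihilated by φ.
-/
lemma IsMixture.isErgodicState [NeZero d] [IsProbabilityMeasure μ] (hψ : ∀ i, ‖ψ i‖ = 1)
    (hφ : IsMixture φ ψ μ) (hT : Ergodic (seqShift ι) μ) : IsErgodicState φ := by
  refine mem_extremePoints_iff_left.2 ⟨hφ.isStationaryState hT.toMeasurePreserving, ?_⟩
  rintro χ₁ (h₁ : IsStationaryState χ₁) χ₂ (h₂ : IsStationaryState χ₂) ⟨t, s, ht, hs, -, hts⟩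
  have hzero : ∀ (Λ : Finset ℤ) (b : LocalMatrix d Λ), φ (localObs Λ b) = 0 →
      χ₁ (localObs Λ b) = 0 := fun Λ b hb => by
    have hlim := (Complex.continuous_re.tendsto _).comp
      (hφ.tendsto_birkhoffAverage hψ hT Λ b hb)
    have hlim' := hlim.const_mul t⁻¹
    rw [Complex.zero_re, mul_zero] at hlim'
    have hle : ‖χ₁ (localObs Λ b)‖ ^ 2 ≤ 0 := by
      refine ge_of_tendsto hlim' ((eventually_ne_atTop 0).mono fun n hn => ?_)
      -- Stationarity replaces b by its time average A before Cauchy–Schwarz is applied; for b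
      -- itself the bound would not tend to 0. The restriction to n ≠ 0 is needed because the empty
      -- average is 0.
      rw [← h₁.apply_birkhoffAverage hn]
      set A := birkhoffAverage ℂ (shift d) id n (localObs Λ b)
      refine (h₁.sq_norm_le A).trans ?_
      have h3 : (φ (star A * A)).re = t * (χ₁ (star A * A)).re + s * (χ₂ (star A * A)).re := by
        rw [← hts]
        simp
      have h4 : 0 ≤ (χ₂ (star A * A)).re := (Complex.le_def.1 (h₂.nonneg A)).1
      rw [Function.comp_apply, h3, le_inv_mul_iff₀ ht]
      nlinarith
    simpa using le_antisymm hle (by positivity)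
  refine ContinuousLinearMap.ext fun a => ?_
  refine localObs_induction (P := fun a => χ₁ a = φ a)
    (isClosed_eq χ₁.continuous φ.continuous) (fun Λ b => ?_) a
  set c := φ (localObs Λ b)
  -- Centring b keeps it local on the same region, so `hzero` applies and gives χ₁(b) = c.
  have hsub : localObs Λ (b - c • 1) = localObs Λ b - c • 1 := Subtype.ext (by
    change localOp Λ (b - c • 1) = localOp Λ b - c • 1
    rw [sub_eq_add_neg, ← neg_smul, localOp_add, localOp_smul, localOp_one, neg_smul,
      sub_eq_add_neg])
  have h := hzero Λ (b - c • 1) (by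
    rw [hsub, map_sub, map_smul, hφ.isState.map_one, smul_eq_mul, mul_one, sub_self])
  rw [hsub, map_sub, map_smul, h₁.map_one, smul_eq_mul, mul_one] at h
  exact sub_eq_zero.1 h

end Ergodic

end QSource

end

/-- A classically correlated quantum source over a linearly independent alphabet of unit vectors
inherits stationarity, ergodicity, weak mixing and strong mixing from its classical
distribution. -/
theorem corollary1 {d : ℕ} {ι : Type*} [Fintype ι] [MeasurableSpace ι]
    [DiscreteMeasurableSpace ι]
    (ψ : ι → EuclideanSpace ℂ (Fin d)) (hψ : LinearIndependent ℂ ψ) (hunit : ∀ i, ‖ψ i‖ = 1)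
    (μ : MeasureTheory.Measure (ℤ → ι)) [MeasureTheory.IsProbabilityMeasure μ] :
    (MeasureTheory.MeasurePreserving (QSource.seqShift ι) μ μ →
      QSource.IsStationarySource (QSource.clsSource ψ (QSource.wordProb μ))) ∧
    (Ergodic (QSource.seqShift ι) μ →
      QSource.IsErgodicSource (QSource.clsSource ψ (QSource.wordProb μ))) ∧
    (QSource.IsWeaklyMixing (QSource.seqShift ι) μ →
      QSource.IsWeaklyMixingSource (QSource.clsSource ψ (QSource.wordProb μ))) ∧
    (QSource.IsStronglyMixing (QSource.seqShift ι) μ →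
      QSource.IsStronglyMixingSource (QSource.clsSource ψ (QSource.wordProb μ))) := by
  -- A probability measure lives on a nonempty space, so some letter exists, and its unit vector
  -- rules out dimension 0.
  have : NeZero d := ⟨by
    rintro rfl
    obtain ⟨ω⟩ := MeasureTheory.nonempty_of_isProbabilityMeasure μ
    have h := hunit (ω 0)
    rw [Subsingleton.elim (ψ (ω 0)) 0, norm_zero] at h
    exact zero_ne_one h⟩
  obtain ⟨φ, hφ⟩ := QSource.exists_isMixture hunit μ
  exact ⟨fun h => ⟨φ, hφ.hasDensities, hφ.isStationaryState h⟩,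
    fun h => ⟨φ, hφ.hasDensities, hφ.isErgodicState hunit h⟩,
    fun h => ⟨φ, hφ.hasDensities, hφ.isWeaklyMixingState h⟩,
    fun h => ⟨φ, hφ.hasDensities, hφ.isStronglyMixingState h⟩⟩
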